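/- Let $D\ge 3$ and $n\ge 2D$, let $\Gamma=J(n,D)$ be the Johnson graph (vertices: the $D$-subsets of an $n$-set $\Omega$; two of them adjacent when they meet in $D-1$ elements), and fix a vertex $x$, with path-length distance $\partial$. For a finite connected graph with vertex set $X$ and adjacency matrix $A$, let $\varepsilon$ be the eccentricity of $x$, let $E_i^*$ be the diagonal matrix with $(E_i^*)_{yy}=1$ if $\partial(x,y)=i$ and $0$ otherwise, and let the Terwilliger algebra (with respect to $x$) be the algebra of complex matrices generated by $A$ and the $E_i^*$. Put $L=\sum_{i=1}^{\varepsilon}E^*_{i-1}AE^*_i$ and $R=\sum_{i=0}^{\varepsilon-1}E^*_{i+1}AE^*_i$. For an algebra $S$ of complex $X\times X$ matrices, an $S$-module is an $S$-invariant subspace of $V=\mathbb{C}^X$; two $S$-modules are isomorphic if some linear bijection between them commutes with the action of $S$. Let $\Gamma_f$ be the bipartite graph obtained from $\Gamma$ by deleting every edge $yz$ with $\partial(x,y)=\partial(x,z)$, and let $T$ and $T_f$ be the Terwilliger algebras of $\Gamma$ and $\Gamma_f$ with respect to $x$. The graph $\Gamma$ *supports a uniform structure* with respect to $x$ if there are a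 tridiagonal complex matrix $U=(e_{ij})_{1\le i,j\le\varepsilon}$ and a vector $f\in\mathbb{C}^{\varepsilon}$ such that $e_{ii}=1$ for all $i$; either $e_{i,i-1}\ne0$ for all $2\le i\le\varepsilon$ or $e_{i-1,i}\neq 0$ for all $2\le i\le\varepsilon$; every principal submatrix $(e_{ij})_{s\le i,j\le t}$ with $1\le s\le t\le\varepsilon$ is nonsingular; and $$e_i^-RL^2+LRL+e_i^+L^2R=f_iL\quad\text{on }E_i^*V\qquad(1\le i\le\varepsilon),$$ where $L,R,E_i^*,\varepsilon$ are those of $\Gamma_f$, $e_i^-=e_{i,i-1}$ $(i\ge2)$, $e_i^+=e_{i,i+1}$ $(i\le\varepsilon-1)$, $e_1^-=e_\varepsilon^+=0$. The *endpoint* of an irreducible $T$-module $W$ is $\min\{i: E_i^*W\ne0\}$, its *diameter* is $|\{i:E_i^*W\neq0\}|-1$, and its *dual endpoint* is $\min\{i:E_iW\ne0\}$, where $E_i$ is the orthogonal projection of $V$ onto the eigenspace of the adjacency matrix of $\Gamma$ for its $i$-th largest eigenvalue $\theta_i$ ($\theta_0>\theta_1>\cdots$). **Theorem.** (i) $\Gamma=J(n,D)$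 does not support a uniform structure with respect to $x$. (ii) If $n>2D$, then every irreducible $T$-module with endpoint $1$ and diameter $D-2$ has dual endpoint $1$ or $2$; for each of these two values there is, up to isomorphism of $T$-modules, exactly one such module. These two modules are also $T_f$-modules, and they are not isomorphic as $T_f$-modules. -/

import Mathlib

open Matrix

namespace UniformStructure

noncomputable section

/-! Throughout, `X` is the finite vertex set of a graph and `X → ℂ` is the standard module. -/

variable {X : Type*} [Fintype X] [DecidableEq X]

open Classical in
/-- The adjacency matrix of `G`, with complex entries. -/
def adjacency (G : SimpleGraph X) : Matrix X X ℂ := G.adjMatrix ℂ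

/-- The eccentricity of the vertex `x`: the largest distance from `x`. -/
def eccentricity (G : SimpleGraph X) (x : X) : ℕ := Finset.univ.sup fun y => G.dist x y

/-- The `i`-th dual idempotent of `G` with respect to `x`
(it is the zero matrix when `i` exceeds the eccentricity of a connected graph). -/
def dualIdempotent (G : SimpleGraph X) (x : X) (i : ℕ) : Matrix X X ℂ :=
  Matrix.diagonal fun y => if G.dist x y = i then 1 else 0

/-- The Terwilliger algebra of `G` with respect to `x`: the algebra generated by the adjacency
matrix and the dual idempotents. -/
def terwilligerAlgebra (G : SimpleGraph X) (x : X) : Subalgebra ℂ (Matrix X X ℂ) :=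
  Algebra.adjoin ℂ ({adjacency G} ∪ Set.range (dualIdempotent G x))

/-- The lowering matrix of `G` with respect to `x`. -/
def lowering (G : SimpleGraph X) (x : X) : Matrix X X ℂ :=
  ∑ i ∈ Finset.Icc 1 (eccentricity G x),
    dualIdempotent G x (i - 1) * adjacency G * dualIdempotent G x i

/-- The raising matrix of `G` with respect to `x`. -/
def raising (G : SimpleGraph X) (x : X) : Matrix X X ℂ :=
  ∑ i ∈ Finset.range (eccentricity G x),
    dualIdempotent G x (i + 1) * adjacency G * dualIdempotent G x i

/-! ### Modules of the Terwilliger algebra -/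

/-- A `T`-module: a subspace of the standard module that is invariant under `T = T(x)`. -/
def IsTModule (G : SimpleGraph X) (x : X) (W : Submodule ℂ (X → ℂ)) : Prop :=
  ∀ B ∈ terwilligerAlgebra G x, ∀ w ∈ W, B *ᵥ w ∈ W

/-- An irreducible `T`-module. -/
def IsIrreducibleTModule (G : SimpleGraph X) (x : X) (W : Submodule ℂ (X → ℂ)) : Prop :=
  IsTModule G x W ∧ W ≠ ⊥ ∧ ∀ U : Submodule ℂ (X → ℂ), IsTModule G x U → U ≤ W → U = ⊥ ∨ U = W

/-- Two `T`-modules are `T`-isomorphic when some linear isomorphism between them commutes with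
the action of every `B ∈ T`. (For a `T`-module `W` the hypothesis `hBw` always holds.) -/
def IsTIsomorphic (G : SimpleGraph X) (x : X) (W W' : Submodule ℂ (X → ℂ)) : Prop :=
  ∃ σ : W ≃ₗ[ℂ] W', ∀ B ∈ terwilligerAlgebra G x, ∀ (w : X → ℂ) (hw : w ∈ W) (hBw : B *ᵥ w ∈ W),
    (σ ⟨B *ᵥ w, hBw⟩ : X → ℂ) = B *ᵥ (σ ⟨w, hw⟩ : X → ℂ)

/-- The set of all `i` with `E*ᵢ W ≠ 0`. -/
def dualSupport (G : SimpleGraph X) (x : X) (W : Submodule ℂ (X → ℂ)) : Set ℕ :=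
  {i | ∃ w ∈ W, dualIdempotent G x i *ᵥ w ≠ 0}

/-- The endpoint of `W`. -/
def endpoint (G : SimpleGraph X) (x : X) (W : Submodule ℂ (X → ℂ)) : ℕ :=
  sInf (dualSupport G x W)

/-- The diameter of `W`: the number of `i` with `E*ᵢ W ≠ 0`, minus one. -/
def moduleDiameter (G : SimpleGraph X) (x : X) (W : Submodule ℂ (X → ℂ)) : ℕ :=
  (dualSupport G x W).ncard - 1

open Classical in
/-- The finite set of distinct (real) eigenvalues of the adjacency matrix. -/
def eigenvalues (G : SimpleGraph X) : Finset ℝ :=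
  (Matrix.finite_real_spectrum (A := G.adjMatrix ℝ)).toFinset

/-- The primitive idempotent associated with the eigenvalue `θ`: the element of the adjacency
algebra obtained by evaluating at `A` the Lagrange polynomial that is `1` at `θ` and `0` at
every other eigenvalue, that is, the orthogonal projection onto the `θ`-eigenspace of `A`. -/
def primitiveIdempotent (G : SimpleGraph X) (θ : ℝ) : Matrix X X ℂ :=
  Polynomial.aeval (adjacency G) (Lagrange.basis (eigenvalues G) (fun η : ℝ => (η : ℂ)) θ)

/-- The position `i` of `θ = θᵢ` in the original (decreasing) ordering `θ₀ > θ₁ > ⋯` of the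
eigenvalues: the number of eigenvalues larger than `θ`. -/
def eigenvalueIndex (G : SimpleGraph X) (θ : ℝ) : ℕ :=
  ((eigenvalues G).filter fun η => θ < η).card

/-- The dual endpoint of `W` with respect to the original ordering of the primitive idempotents:
the least `i` with `Eᵢ W ≠ 0`. -/
def dualEndpoint (G : SimpleGraph X) (W : Submodule ℂ (X → ℂ)) : ℕ :=
  sInf {i | ∃ θ ∈ eigenvalues G, eigenvalueIndex G θ = i ∧
    ∃ w ∈ W, primitiveIdempotent G θ *ᵥ w ≠ 0}

/-- `W` is an irreducible `T`-module of endpoint `r`, diameter `d` and dual endpoint `t`. -/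
def IsIrreducibleOfType (G : SimpleGraph X) (x : X) (r d t : ℕ) (W : Submodule ℂ (X → ℂ)) : Prop :=
  IsIrreducibleTModule G x W ∧ endpoint G x W = r ∧ moduleDiameter G x W = d ∧
    dualEndpoint G W = t

/-! ### Uniform structures -/

/-- `U = (e i j)`, `1 ≤ i, j ≤ ε`, is a parameter matrix. The matrix is extended by zero to all
of `ℕ × ℕ`, so that `e⁻₁ = U 1 0 = 0` and `e⁺_ε = U ε (ε + 1) = 0`. -/
structure IsParameterMatrix (ε : ℕ) (U : Matrix ℕ ℕ ℂ) : Prop where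
  extended_by_zero : ∀ i j, ¬ (i ∈ Finset.Icc 1 ε ∧ j ∈ Finset.Icc 1 ε) → U i j = 0
  tridiagonal : ∀ i j, i + 1 < j ∨ j + 1 < i → U i j = 0
  diagonal_one : ∀ i ∈ Finset.Icc 1 ε, U i i = 1
  off_diagonal : (∀ i ∈ Finset.Icc 2 ε, U i (i - 1) ≠ 0) ∨ (∀ i ∈ Finset.Icc 2 ε, U (i - 1) i ≠ 0)
  principal_nonsingular : ∀ s t, 1 ≤ s → s ≤ t → t ≤ ε →
    (Matrix.of fun i j : Finset.Icc s t => U i j).det ≠ 0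

/-- `(U, f)` is a uniform structure of the (bipartite) graph `G` with respect to `x`; here
`e⁻ᵢ = U i (i - 1)` and `e⁺ᵢ = U i (i + 1)`. -/
def IsUniformStructure (G : SimpleGraph X) (x : X) (U : Matrix ℕ ℕ ℂ) (f : ℕ → ℂ) : Prop :=
  IsParameterMatrix (eccentricity G x) U ∧
  ∀ i ∈ Finset.Icc 1 (eccentricity G x), ∀ v : X → ℂ,
    (U i (i - 1) • (raising G x * lowering G x ^ 2)
      + lowering G x * raising G x * lowering G x
      + U i (i + 1) • (lowering G x ^ 2 * raising G x)) *ᵥ (dualIdempotent G x i *ᵥ v)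
    = (f i • lowering G x) *ᵥ (dualIdempotent G x i *ᵥ v)

/-- The graph `Γ_f`: remove from `G` all edges whose ends are equidistant from `x`. -/
def fullGraph (G : SimpleGraph X) (x : X) : SimpleGraph X where
  Adj y z := G.Adj y z ∧ G.dist x y ≠ G.dist x z
  symm := ⟨fun _ _ h => ⟨h.1.symm, h.2.symm⟩⟩
  loopless := ⟨fun _ h => h.2 rfl⟩

/-- `G` supports a uniform structure with respect to `x`: the graph `Γ_f` admits one. -/
def SupportsUniformStructure (G : SimpleGraph X) (x : X) : Prop :=
  ∃ (U : Matrix ℕ ℕ ℂ) (f : ℕ → ℂ), IsUniformStructure (fullGraph G x) x U f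

end

/-! ### Johnson graphs -/

/-- The vertices of `J(n, D)`: the `D`-element subsets of an `n`-element set. -/
abbrev JohnsonVertex (n D : ℕ) : Type := {s : Finset (Fin n) // s.card = D}

/-- The Johnson graph `J(n, D)`: two `D`-subsets are adjacent when they meet in `D - 1` elements. -/
def johnson (n D : ℕ) : SimpleGraph (JohnsonVertex n D) where
  Adj s t := (s.1 ∩ t.1).card + 1 = D
  symm := ⟨fun s t h => by rw [Finset.inter_comm]; exact h⟩
  loopless := ⟨fun s h => by rw [Finset.inter_self, s.2] at h; omega⟩

end UniformStructure

/-! Everything is computed on explicit modules. A function `φ` on finite sets is harmonic of degree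
`a` on `x` and `b` on the complement of `x` when inserting or erasing elements of either side
multiplies it by a prescribed scalar. The case needed is `a, b ≤ 1`: constants for degree 0, sums
over the set of weights with total zero for degree 1. Moving to a neighbour in the Johnson graph
erases one element and inserts another, so `A` sends `E*ⱼ φ` to a combination of `E*ᵢ φ` with `|i -
j| ≤ 1`, whose coefficients depend only on `n, D, a, b` (`isLadder_restrict`). Hence the vectors
`E*ᵢ φ` span a `T`-module, and deleting the edges inside levels merely removes the diagonal
coefficients.

For (i), the uniform relation on the four ladders `(a, b)` in `{0, 1}²` involves the same `U` and
`f`. Differences in `a` and `b` eliminate `f` and leave three linear equations for the two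
off-diagonal entries of a row (`uniform_coefficients`). They are inconsistent, except when `n = 2D`
with `D` even; there the two middle rows contain a zero below and a zero above the diagonal
respectively, against the definition of a parameter matrix.

For (ii), a vector on the neighbours of `x` is a matrix indexed by `x` and its complement, on which
the local graph acts through row and column sums. If `n > 2D`, these actions extract from any module
of endpoint 1 a nonzero `E*₁ φ` with `φ` harmonic and `(a, b)` one of `(0, 1)`, `(1, 0)`, `(1, 1)`
(`exists_harmonic_of_endpoint_one`). An irreducible module is therefore a ladder module, of diameter
`D - a - 1`; diameter `D - 2` means `a = 1`. Its dual endpoint is `a + b`: `φ` itself is an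
eigenvector for `θ_{a+b}`, while an eigenvector for `θⱼ` can be lowered in the Boolean lattice to a
nonzero function on `j`-sets, and a harmonic function vanishes on sets too small for its degrees. So
`b` is determined by the dual endpoint, and equal `b` gives equal coefficients and supports, hence
isomorphic modules. Over `T_f` the modules for `b = 0` and `b = 1` are separated by the scalar of
the closed walk from level 1 to level 2 and back. -/

namespace UniformStructure

noncomputable section

/-! ### Distances from a level function, and radial multiples of a vector -/

section Radial

variable {X : Type*} {G : SimpleGraph X} {x : X}

/-- Multiplication of `φ` by functions of the distance from `x`. -/
def radialMul (G : SimpleGraph X) (x : X) (φ : X → ℂ) : (ℕ → ℂ) →ₗ[ℂ] (X → ℂ) where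
  toFun s y := s (G.dist x y) * φ y
  map_add' s t := by ext y; simp [add_mul]
  map_smul' r s := by ext y; simp [mul_assoc]

/-- The span of the vectors `E*ᵢ φ`. -/
abbrev radialSpan (G : SimpleGraph X) (x : X) (φ : X → ℂ) : Submodule ℂ (X → ℂ) :=
  LinearMap.range (radialMul G x φ)

theorem radialMul_apply (s : ℕ → ℂ) (φ : X → ℂ) (y : X) :
    radialMul G x φ s y = s (G.dist x y) * φ y := rfl

theorem radialMul_mem (s : ℕ → ℂ) (φ : X → ℂ) : radialMul G x φ s ∈ radialSpan G x φ :=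
  ⟨s, rfl⟩

theorem self_mem_radialSpan (φ : X → ℂ) : φ ∈ radialSpan G x φ :=
  ⟨fun _ => 1, by ext y; rw [radialMul_apply, one_mul]⟩

/-- Distances from `x` are determined by a level function that drops along some edge at every
vertex other than `x` and changes by at most one along each edge. -/
theorem dist_eq_of_level (l : X → ℕ) (h0 : ∀ y, l y = 0 ↔ y = x)
    (hle : ∀ y z, G.Adj y z → l z ≤ l y + 1)
    (hdown : ∀ y, l y ≠ 0 → ∃ z, G.Adj y z ∧ l z + 1 = l y) (y : X) : G.dist x y = l y := by
  have hw : ∀ (k : ℕ) (y : X), l y = k → ∃ p : G.Walk y x, p.length = k := by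
    intro k
    induction k with
    | zero =>
      intro y hy
      obtain rfl := (h0 y).1 hy
      exact ⟨SimpleGraph.Walk.nil, rfl⟩
    | succ k ih =>
      intro y hy
      obtain ⟨z, hz, hl⟩ := hdown y (by omega)
      obtain ⟨p, hp⟩ := ih z (by omega)
      exact ⟨SimpleGraph.Walk.cons hz p, by simp [hp]⟩
  have hlen : ∀ {u v : X} (p : G.Walk u v), l v ≤ l u + p.length := by
    intro u v p
    induction p with
    | nil => simp
    | cons h p ih =>
      have := hle _ _ h
      rw [SimpleGraph.Walk.length_cons]
      omega
  obtain ⟨p, hp⟩ := hw _ y rfl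
  apply le_antisymm
  · rw [SimpleGraph.dist_comm, ← hp]
    exact SimpleGraph.dist_le p
  · have hr : G.Reachable x y := ⟨p.reverse⟩
    obtain ⟨q, hq⟩ := hr.exists_walk_length_eq_dist
    have := hlen q
    rw [(h0 x).2 rfl] at this
    omega

/-- Both ranges are the same quotient of `M`. For `radialMul` this makes the map `E*ᵢ φ ↦ E*ᵢ φ'`
well defined without choosing bases. -/
theorem exists_linearEquiv_range {M N : Type*} [AddCommGroup M] [Module ℂ M] [AddCommGroup N]
    [Module ℂ N] (f g : M →ₗ[ℂ] N) (h : LinearMap.ker f = LinearMap.ker g) :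
    ∃ σ : LinearMap.range f ≃ₗ[ℂ] LinearMap.range g,
      ∀ v s (hv : v ∈ LinearMap.range f), v = f s → (σ ⟨v, hv⟩ : N) = g s := by
  refine ⟨f.quotKerEquivRange.symm ≪≫ₗ Submodule.quotEquivOfEq _ _ h ≪≫ₗ g.quotKerEquivRange, ?_⟩
  rintro v s hv rfl
  have : f.quotKerEquivRange.symm ⟨f s, hv⟩ = Submodule.Quotient.mk s := by
    rw [LinearEquiv.symm_apply_eq]
    rfl
  rw [LinearEquiv.trans_apply, LinearEquiv.trans_apply, this]
  rfl

end Radial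

/-! ### Ladder modules -/

section Modules

variable {X : Type*} [Fintype X] [DecidableEq X] {G : SimpleGraph X} {x : X}

theorem dualIdempotent_mulVec_apply (G : SimpleGraph X) (x : X) (i : ℕ) (v : X → ℂ) (y : X) :
    (dualIdempotent G x i *ᵥ v) y = if G.dist x y = i then v y else 0 := by
  simp [dualIdempotent, Matrix.mulVec_diagonal]

theorem adjacency_mem_terwilligerAlgebra (G : SimpleGraph X) (x : X) :
    adjacency G ∈ terwilligerAlgebra G x :=
  Algebra.subset_adjoin (Or.inl rfl)

theorem dualIdempotent_mem_terwilligerAlgebra (G : SimpleGraph X) (x : X) (i : ℕ) :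
    dualIdempotent G x i ∈ terwilligerAlgebra G x :=
  Algebra.subset_adjoin (Or.inr ⟨i, rfl⟩)

theorem isTModule_of_generators {W : Submodule ℂ (X → ℂ)}
    (hA : ∀ w ∈ W, adjacency G *ᵥ w ∈ W) (hE : ∀ i, ∀ w ∈ W, dualIdempotent G x i *ᵥ w ∈ W) :
    IsTModule G x W := by
  intro B hB
  induction hB using Algebra.adjoin_induction with
  | mem B hB =>
    rcases hB with rfl | ⟨i, rfl⟩
    · exact hA
    · exact hE i
  | algebraMap r =>
    intro w hw
    rw [Algebra.algebraMap_eq_smul_one, Matrix.smul_mulVec, Matrix.one_mulVec]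
    exact W.smul_mem r hw
  | add B C _ _ hB hC =>
    intro w hw
    rw [Matrix.add_mulVec]
    exact W.add_mem (hB w hw) (hC w hw)
  | mul B C _ _ hB hC =>
    intro w hw
    rw [← Matrix.mulVec_mulVec]
    exact hB _ (hC w hw)

theorem isTIsomorphic_of_generators {W W' : Submodule ℂ (X → ℂ)} (hW : IsTModule G x W)
    (σ : W ≃ₗ[ℂ] W')
    (hA : ∀ (w : X → ℂ) (hw : w ∈ W) (hBw : adjacency G *ᵥ w ∈ W),
      (σ ⟨adjacency G *ᵥ w, hBw⟩ : X → ℂ) = adjacency G *ᵥ (σ ⟨w, hw⟩ : X → ℂ))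
    (hE : ∀ i (w : X → ℂ) (hw : w ∈ W) (hBw : dualIdempotent G x i *ᵥ w ∈ W),
      (σ ⟨dualIdempotent G x i *ᵥ w, hBw⟩ : X → ℂ)
        = dualIdempotent G x i *ᵥ (σ ⟨w, hw⟩ : X → ℂ)) :
    IsTIsomorphic G x W W' := by
  refine ⟨σ, fun B hB => ?_⟩
  unfold terwilligerAlgebra at hB
  induction hB using Algebra.adjoin_induction with
  | mem B hB =>
    rcases hB with rfl | ⟨i, rfl⟩
    · exact hA
    · exact hE i
  | algebraMap r =>
    intro w hw hBw
    have h : (⟨algebraMap ℂ (Matrix X X ℂ) r *ᵥ w, hBw⟩ : W) = r • ⟨w, hw⟩ := by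
      ext1
      simp [Algebra.algebraMap_eq_smul_one, Matrix.smul_mulVec]
    rw [h, map_smul]
    simp [Algebra.algebraMap_eq_smul_one, Matrix.smul_mulVec]
  | add B C hB' hC' hB hC =>
    intro w hw hBw
    have h : (⟨(B + C) *ᵥ w, hBw⟩ : W) = ⟨B *ᵥ w, hW B hB' w hw⟩ + ⟨C *ᵥ w, hW C hC' w hw⟩ := by
      ext1
      simp [Matrix.add_mulVec]
    rw [h, map_add, Matrix.add_mulVec, Submodule.coe_add, hB w hw, hC w hw]
  | mul B C hB' hC' hB hC =>
    intro w hw hBw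
    have h : (⟨(B * C) *ᵥ w, hBw⟩ : W) = ⟨B *ᵥ (C *ᵥ w),
        hW B hB' _ (hW C hC' w hw)⟩ := by
      ext1
      simp [Matrix.mulVec_mulVec]
    rw [h, hB _ (hW C hC' w hw), hC w hw, Matrix.mulVec_mulVec]

/-- `φ` is a ladder with coefficients `c` when `A (E*ⱼ φ) = ∑ᵢ c i j • E*ᵢ φ` for all `j`. -/
def IsLadder (G : SimpleGraph X) (x : X) (φ : X → ℂ) (c : ℕ → ℕ → ℂ) : Prop :=
  ∀ j y, (adjacency G *ᵥ (dualIdempotent G x j *ᵥ φ)) y = c (G.dist x y) j * φ y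

theorem dualIdempotent_mulVec_radialMul (i : ℕ) (s : ℕ → ℂ) (φ : X → ℂ) :
    dualIdempotent G x i *ᵥ radialMul G x φ s
      = radialMul G x φ (fun j => if j = i then s j else 0) := by
  ext y
  rw [dualIdempotent_mulVec_apply, radialMul_apply, radialMul_apply]
  split_ifs <;> simp

theorem dualIdempotent_mulVec_radialMul' (i : ℕ) (s : ℕ → ℂ) (φ : X → ℂ) :
    dualIdempotent G x i *ᵥ radialMul G x φ s = s i • (dualIdempotent G x i *ᵥ φ) := by
  ext y
  rw [dualIdempotent_mulVec_apply, radialMul_apply, Pi.smul_apply, dualIdempotent_mulVec_apply]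
  split_ifs with h
  · rw [h, smul_eq_mul]
  · simp

theorem dualIdempotent_mulVec_mem_radialSpan (i : ℕ) (φ : X → ℂ) :
    dualIdempotent G x i *ᵥ φ ∈ radialSpan G x φ := by
  refine ⟨fun j => if j = i then 1 else 0, ?_⟩
  ext y
  rw [dualIdempotent_mulVec_apply, radialMul_apply]
  split_ifs <;> simp

theorem radialMul_eq_sum (s : ℕ → ℂ) (φ : X → ℂ) :
    radialMul G x φ s
      = ∑ j ∈ Finset.range (eccentricity G x + 1), s j • (dualIdempotent G x j *ᵥ φ) := by
  ext y
  have hy : G.dist x y ∈ Finset.range (eccentricity G x + 1) := by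
    have : G.dist x y ≤ eccentricity G x :=
      Finset.le_sup (f := fun y => G.dist x y) (Finset.mem_univ y)
    simpa using Nat.lt_succ_of_le this
  rw [Finset.sum_apply, Finset.sum_eq_single_of_mem _ hy]
  · rw [Pi.smul_apply, dualIdempotent_mulVec_apply, if_pos rfl, radialMul_apply, smul_eq_mul]
  · intro j _ hj
    rw [Pi.smul_apply, dualIdempotent_mulVec_apply, if_neg (Ne.symm hj), smul_zero]

theorem radialSpan_le {φ : X → ℂ} {U : Submodule ℂ (X → ℂ)}
    (h : ∀ i, dualIdempotent G x i *ᵥ φ ∈ U) : radialSpan G x φ ≤ U := by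
  rintro _ ⟨s, rfl⟩
  rw [radialMul_eq_sum]
  exact U.sum_mem fun j _ => U.smul_mem _ (h j)

namespace IsLadder

variable {φ φ' : X → ℂ} {c c' : ℕ → ℕ → ℂ}

theorem adjacency_mulVec_radialMul (h : IsLadder G x φ c) (s : ℕ → ℂ) :
    adjacency G *ᵥ radialMul G x φ s
      = radialMul G x φ
        (fun i => ∑ j ∈ Finset.range (eccentricity G x + 1), c i j * s j) := by
  ext y
  rw [radialMul_eq_sum, Matrix.mulVec_sum, Finset.sum_apply, radialMul_apply, Finset.sum_mul]
  refine Finset.sum_congr rfl fun j _ => ?_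
  rw [Matrix.mulVec_smul, Pi.smul_apply, h, smul_eq_mul]
  ring

theorem isTModule (h : IsLadder G x φ c) : IsTModule G x (radialSpan G x φ) := by
  refine isTModule_of_generators ?_ ?_
  · rintro _ ⟨s, rfl⟩
    rw [h.adjacency_mulVec_radialMul]
    exact radialMul_mem _ _
  · rintro i _ ⟨s, rfl⟩
    rw [dualIdempotent_mulVec_radialMul]
    exact radialMul_mem _ _

/-- The action of `E*ᵢ A` on `E*ⱼ φ`. -/
theorem dualIdempotent_adjacency (h : IsLadder G x φ c) (i j : ℕ) :
    dualIdempotent G x i *ᵥ (adjacency G *ᵥ (dualIdempotent G x j *ᵥ φ))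
      = c i j • (dualIdempotent G x i *ᵥ φ) := by
  ext y
  rw [dualIdempotent_mulVec_apply, h, Pi.smul_apply, dualIdempotent_mulVec_apply]
  split_ifs with hy
  · rw [hy, smul_eq_mul]
  · simp

/-- Each module is the space of sequences modulo those vanishing on the levels where its function is
nonzero, so equal supports give equal kernels. The generators act on sequences by formulas that
involve only `c`, so the identity on sequences descends to an isomorphism. -/
theorem isTIsomorphic (h : IsLadder G x φ c) (h' : IsLadder G x φ' c)
    (hs : ∀ i, (∃ y, G.dist x y = i ∧ φ y ≠ 0) ↔ ∃ y, G.dist x y = i ∧ φ' y ≠ 0) :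
    IsTIsomorphic G x (radialSpan G x φ) (radialSpan G x φ') := by
  have key : ∀ (ψ : X → ℂ) (s : ℕ → ℂ), s ∈ LinearMap.ker (radialMul G x ψ) ↔
      ∀ i, (∃ y, G.dist x y = i ∧ ψ y ≠ 0) → s i = 0 := by
    intro ψ s
    rw [LinearMap.mem_ker]
    constructor
    · rintro hs i ⟨y, rfl, hy⟩
      have := congrFun hs y
      rw [radialMul_apply, Pi.zero_apply, mul_eq_zero] at this
      exact this.resolve_right hy
    · intro hs
      ext y
      rw [radialMul_apply, Pi.zero_apply, mul_eq_zero]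
      by_cases hy : ψ y = 0
      · exact Or.inr hy
      · exact Or.inl (hs _ ⟨y, rfl, hy⟩)
  have hker : LinearMap.ker (radialMul G x φ) = LinearMap.ker (radialMul G x φ') := by
    ext s
    rw [key, key]
    exact forall_congr' fun i => by rw [hs i]
  obtain ⟨σ, hσ⟩ := exists_linearEquiv_range _ _ hker
  refine isTIsomorphic_of_generators h.isTModule σ ?_ ?_
  · intro w hw hB
    have ⟨s, hs⟩ := hw
    rw [hσ w s hw hs.symm, h'.adjacency_mulVec_radialMul]
    exact hσ _ _ _ (by rw [← hs, h.adjacency_mulVec_radialMul s])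
  · intro i w hw hB
    have ⟨s, hs⟩ := hw
    rw [hσ w s hw hs.symm, dualIdempotent_mulVec_radialMul]
    exact hσ _ _ _ (by rw [← hs, dualIdempotent_mulVec_radialMul])

/-- A submodule containing one vector `E*ᵢ φ` contains the next one up the ladder. -/
theorem step_mem (h : IsLadder G x φ c) {U : Submodule ℂ (X → ℂ)} (hU : IsTModule G x U)
    {i j : ℕ} (hc : c i j ≠ 0) (hj : dualIdempotent G x j *ᵥ φ ∈ U) :
    dualIdempotent G x i *ᵥ φ ∈ U := by
  have h1 := hU _ (dualIdempotent_mem_terwilligerAlgebra G x i) _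
    (hU _ (adjacency_mem_terwilligerAlgebra G x) _ hj)
  rw [h.dualIdempotent_adjacency] at h1
  exact (U.smul_mem_iff hc).1 h1

/-- Each level contributes at most a line, so a nonzero submodule contains some nonzero `E*ᵢ φ`.
Nonvanishing coefficients between consecutive levels carry it down to `r` and then up through every
level to `e`. -/
theorem isIrreducibleTModule (h : IsLadder G x φ c) {r e : ℕ} (hre : r ≤ e)
    (hs : ∀ i, (∃ y, G.dist x y = i ∧ φ y ≠ 0) ↔ i ∈ Finset.Icc r e)
    (hup : ∀ i, r ≤ i → i < e → c (i + 1) i ≠ 0)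
    (hdown : ∀ i, r ≤ i → i < e → c i (i + 1) ≠ 0) :
    IsIrreducibleTModule G x (radialSpan G x φ) := by
  refine ⟨h.isTModule, ?_, ?_⟩
  · obtain ⟨y, -, hy⟩ := (hs r).2 (Finset.mem_Icc.2 ⟨le_rfl, hre⟩)
    intro h0
    have h1 : φ ∈ radialSpan G x φ := self_mem_radialSpan φ
    rw [h0, Submodule.mem_bot] at h1
    exact hy (congrFun h1 y)
  · intro U hU hle
    by_cases hU0 : U = ⊥
    · exact Or.inl hU0
    refine Or.inr (le_antisymm hle ?_)
    obtain ⟨u, hu, hu0⟩ := (Submodule.ne_bot_iff U).1 hU0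
    obtain ⟨s, rfl⟩ := hle hu
    obtain ⟨y, hy⟩ := Function.ne_iff.1 hu0
    rw [radialMul_apply, Pi.zero_apply, mul_ne_zero_iff] at hy
    obtain ⟨hsy, hφy⟩ := hy
    obtain ⟨h1, h2⟩ := Finset.mem_Icc.1 ((hs _).1 ⟨y, rfl, hφy⟩)
    have hstart : dualIdempotent G x (G.dist x y) *ᵥ φ ∈ U := by
      have := hU _ (dualIdempotent_mem_terwilligerAlgebra G x (G.dist x y)) _ hu
      rw [dualIdempotent_mulVec_radialMul'] at this
      exact (U.smul_mem_iff hsy).1 this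
    have hr : dualIdempotent G x r *ᵥ φ ∈ U :=
      Nat.decreasingInduction'
        (P := fun k => dualIdempotent G x k *ᵥ φ ∈ U)
        (fun k hk hrk hP => h.step_mem hU (hdown k hrk (hk.trans_le h2)) hP) h1 hstart
    have hall : ∀ k, r ≤ k → k ≤ e → dualIdempotent G x k *ᵥ φ ∈ U := by
      intro k hk
      induction k, hk using Nat.le_induction with
      | base => exact fun _ => hr
      | succ k hk ih => exact fun hke => h.step_mem hU (hup k hk hke) (ih (by omega))
    refine radialSpan_le fun i => ?_
    by_cases hi : r ≤ i ∧ i ≤ e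
    · exact hall i hi.1 hi.2
    · have : dualIdempotent G x i *ᵥ φ = 0 := by
        ext z
        rw [dualIdempotent_mulVec_apply]
        split_ifs with hz
        · by_contra hne
          exact hi (Finset.mem_Icc.1 ((hs i).1 ⟨z, hz, hne⟩))
        · rfl
      rw [this]
      exact U.zero_mem

theorem lowering_mulVec (h : IsLadder G x φ c) {j : ℕ} (hj : j + 1 ≤ eccentricity G x) :
    lowering G x *ᵥ (dualIdempotent G x (j + 1) *ᵥ φ)
      = c j (j + 1) • (dualIdempotent G x j *ᵥ φ) := by
  have hE : ∀ i k, i ≠ k → dualIdempotent G x i *ᵥ (dualIdempotent G x k *ᵥ φ) = 0 := by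
    intro i k hik
    ext y
    rw [dualIdempotent_mulVec_apply, dualIdempotent_mulVec_apply]
    split_ifs <;> first | rfl | omega
  have hE' : ∀ i, dualIdempotent G x i *ᵥ (dualIdempotent G x i *ᵥ φ)
      = dualIdempotent G x i *ᵥ φ := by
    intro i
    ext y
    rw [dualIdempotent_mulVec_apply, dualIdempotent_mulVec_apply]
    split_ifs <;> rfl
  rw [lowering, Matrix.sum_mulVec, Finset.sum_eq_single_of_mem (j + 1)]
  · rw [← Matrix.mulVec_mulVec, ← Matrix.mulVec_mulVec, hE', h.dualIdempotent_adjacency,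
      Nat.add_sub_cancel]
  · exact Finset.mem_Icc.2 ⟨by omega, hj⟩
  · intro i _ hi
    rw [← Matrix.mulVec_mulVec, hE i _ hi, Matrix.mulVec_zero]

theorem raising_mulVec (h : IsLadder G x φ c) {j : ℕ} (hj : j < eccentricity G x) :
    raising G x *ᵥ (dualIdempotent G x j *ᵥ φ)
      = c (j + 1) j • (dualIdempotent G x (j + 1) *ᵥ φ) := by
  have hE : ∀ i k, i ≠ k → dualIdempotent G x i *ᵥ (dualIdempotent G x k *ᵥ φ) = 0 := by
    intro i k hik
    ext y
    rw [dualIdempotent_mulVec_apply, dualIdempotent_mulVec_apply]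
    split_ifs <;> first | rfl | omega
  have hE' : ∀ i, dualIdempotent G x i *ᵥ (dualIdempotent G x i *ᵥ φ)
      = dualIdempotent G x i *ᵥ φ := by
    intro i
    ext y
    rw [dualIdempotent_mulVec_apply, dualIdempotent_mulVec_apply]
    split_ifs <;> rfl
  rw [raising, Matrix.sum_mulVec, Finset.sum_eq_single_of_mem j]
  · rw [← Matrix.mulVec_mulVec, ← Matrix.mulVec_mulVec, hE', h.dualIdempotent_adjacency]
  · exact Finset.mem_range.2 hj
  · intro i _ hi
    rw [← Matrix.mulVec_mulVec, hE i _ hi, Matrix.mulVec_zero]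

/-- The relation that a uniform structure forces on the coefficients of a ladder. -/
theorem uniform_relation (h : IsLadder G x φ c) {U : Matrix ℕ ℕ ℂ} {f : ℕ → ℂ}
    (hU : IsUniformStructure G x U f) {i : ℕ} (hi : i + 3 ≤ eccentricity G x)
    (hc : c (i + 1) (i + 2) ≠ 0) (hy : ∃ y, G.dist x y = i + 1 ∧ φ y ≠ 0) :
    U (i + 2) (i + 1) * (c i (i + 1) * c (i + 1) i) + c (i + 1) (i + 2) * c (i + 2) (i + 1)
      + U (i + 2) (i + 3) * (c (i + 2) (i + 3) * c (i + 3) (i + 2)) = f (i + 2) := by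
  obtain ⟨y, hy, hφ⟩ := hy
  have h1 := hU.2 (i + 2) (Finset.mem_Icc.2 ⟨by omega, by omega⟩) φ
  rw [show i + 2 - 1 = i + 1 by omega, show i + 2 + 1 = i + 3 by omega] at h1
  simp only [Matrix.add_mulVec, Matrix.smul_mulVec, pow_two, ← Matrix.mulVec_mulVec] at h1
  simp only [h.lowering_mulVec (j := i + 1) (by omega), h.raising_mulVec (j := i + 2) (by omega),
    h.lowering_mulVec (j := i + 2) (by omega), h.raising_mulVec (j := i + 1) (by omega),
    h.lowering_mulVec (j := i) (by omega), h.raising_mulVec (j := i) (by omega),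
    Matrix.mulVec_smul] at h1
  have h2 := congrFun h1 y
  simp only [Pi.add_apply, Pi.smul_apply, smul_eq_mul, dualIdempotent_mulVec_apply, hy,
    if_true] at h2
  -- All terms share this factor, which comes from the one net step down from level `i + 2` to `i +
  -- 1`. What remains are products over single edges of the ladder.
  have h3 : c (i + 1) (i + 2) * φ y ≠ 0 := mul_ne_zero hc hφ
  apply mul_right_cancel₀ h3
  linear_combination h2

end IsLadder

theorem dualSupport_radialSpan (φ : X → ℂ) :
    dualSupport G x (radialSpan G x φ) = {i | ∃ y, G.dist x y = i ∧ φ y ≠ 0} := by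
  ext i
  constructor
  · rintro ⟨_, ⟨s, rfl⟩, h⟩
    obtain ⟨y, hy⟩ := Function.ne_iff.1 h
    rw [dualIdempotent_mulVec_apply, radialMul_apply] at hy
    split_ifs at hy with h1
    · exact ⟨y, h1, right_ne_zero_of_mul hy⟩
    · exact absurd rfl hy
  · rintro ⟨y, hy, h⟩
    refine ⟨φ, self_mem_radialSpan φ, fun h0 => h ?_⟩
    have := congrFun h0 y
    rwa [dualIdempotent_mulVec_apply, if_pos hy] at this

end Modules

/-! ### Harmonic functions on finite sets -/

section Harmonic

variable {α : Type*} [DecidableEq α] {s t : Finset α} {a b : ℕ} {φ : Finset α → ℂ}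

/-- A function on finsets is harmonic of degree `a` on `s` when adding, respectively removing, an
element of `s` acts on it as on the isotypic component of type `(|s| - a, a)`. -/
structure IsHarmonic (s : Finset α) (a : ℕ) (φ : Finset α → ℂ) : Prop where
  up : ∀ z, ∑ j ∈ s \ z, φ (insert j z) = ((s.card : ℂ) - (s ∩ z).card - a) * φ z
  down : ∀ z, ∑ j ∈ s ∩ z, φ (z.erase j) = (((s ∩ z).card : ℂ) - a) * φ z

theorem cast_card_sdiff (s z : Finset α) :
    ((s \ z).card : ℂ) = (s.card : ℂ) - (s ∩ z).card := by
  rw [← Finset.card_sdiff_add_card_inter s z]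
  push_cast
  ring

theorem isHarmonic_zero (h : ∀ z, ∀ j ∈ s, φ (insert j z) = φ z) : IsHarmonic s 0 φ where
  up z := by
    rw [Finset.sum_congr rfl fun j hj => h z j (Finset.mem_sdiff.1 hj).1, Finset.sum_const,
      nsmul_eq_mul, cast_card_sdiff]
    simp
  down z := by
    have : ∀ j ∈ s ∩ z, φ (z.erase j) = φ z := by
      intro j hj
      rw [Finset.mem_inter] at hj
      rw [← h _ j hj.1, Finset.insert_erase hj.2]
    rw [Finset.sum_congr rfl this, Finset.sum_const, nsmul_eq_mul]
    simp

/-- Here `ψ k z` is the increment of `φ` at `k`. The increments over all of `s` sum to zero, so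
those at the missing elements sum to `-φ z`, which is the shift by one in `up`. Erasing each present
element in turn loses `φ z` once in total, which is the shift in `down`. -/
theorem isHarmonic_one {ψ : α → Finset α → ℂ} (hφ : ∀ z, φ z = ∑ k ∈ s ∩ z, ψ k z)
    (hψ : ∀ k z, ∀ j ∈ s, ψ k (insert j z) = ψ k z) (h0 : ∀ z, ∑ k ∈ s, ψ k z = 0) :
    IsHarmonic s 1 φ where
  up z := by
    have h1 : ∀ j ∈ s \ z, φ (insert j z) = ψ j z + φ z := by
      intro j hj
      rw [Finset.mem_sdiff] at hj
      rw [hφ, hφ, Finset.inter_insert_of_mem hj.1, Finset.sum_insert (by simp [hj.2]), hψ _ _ _ hj.1]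
      congr 1
      exact Finset.sum_congr rfl fun k _ => hψ k z j hj.1
    have h2 : ∑ j ∈ s \ z, ψ j z = - φ z := by
      rw [hφ, eq_neg_iff_add_eq_zero, add_comm, Finset.sum_inter_add_sum_sdiff, h0]
    rw [Finset.sum_congr rfl h1, Finset.sum_add_distrib, Finset.sum_const, nsmul_eq_mul,
      cast_card_sdiff, h2]
    push_cast
    ring
  down z := by
    have h1 : ∀ j ∈ s ∩ z, φ (z.erase j) = φ z - ψ j z := by
      intro j hj
      have hj' := Finset.mem_inter.1 hj
      rw [hφ, hφ, Finset.inter_erase, ← Finset.add_sum_erase _ _ hj, add_sub_cancel_left]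
      refine Finset.sum_congr rfl fun k _ => ?_
      rw [← hψ k _ j hj'.1, Finset.insert_erase hj'.2]
    rw [Finset.sum_congr rfl h1, Finset.sum_sub_distrib, Finset.sum_const, nsmul_eq_mul, ← hφ]
    push_cast
    ring

namespace IsHarmonic

theorem eq_zero_of_disjoint (h : IsHarmonic s 1 φ) {z : Finset α} (hz : s ∩ z = ∅) :
    φ z = 0 := by
  simpa [hz] using h.down z

theorem eq_zero_of_subset (h : IsHarmonic s 1 φ) {z : Finset α} (hz : s ⊆ z) : φ z = 0 := by
  simpa [Finset.sdiff_eq_empty_iff_subset.2 hz, Finset.inter_eq_left.2 hz] using h.up z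

/-- A swap is an erasure followed by an insertion. After `j` is erased, harmonicity also counts the
reinsertion of `j`, which returns `z`; subtracting it once for each `j` gives the term `-(s ∩
z).card`. -/
theorem sum_swap_self (h : IsHarmonic s a φ) (z : Finset α) :
    ∑ j ∈ s ∩ z, ∑ k ∈ s \ z, φ (insert k (z.erase j))
      = (((s.card : ℂ) - (s ∩ z).card + 1 - a) * (((s ∩ z).card : ℂ) - a) - (s ∩ z).card)
        * φ z := by
  have h1 : ∀ j ∈ s ∩ z, ∑ k ∈ s \ z, φ (insert k (z.erase j))
      = ((s.card : ℂ) - (s ∩ z).card + 1 - a) * φ (z.erase j) - φ z := by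
    intro j hj
    have hj' := Finset.mem_inter.1 hj
    have h2 := h.up (z.erase j)
    have h3 : s \ z.erase j = insert j (s \ z) := by
      ext k
      simp only [Finset.mem_sdiff, Finset.mem_erase, Finset.mem_insert]
      by_cases hk : k = j
      · subst hk; simp [hj'.1]
      · simp [hk]
    have h4 : ((s ∩ z.erase j).card : ℂ) = (s ∩ z).card - 1 := by
      rw [Finset.inter_erase, Finset.cast_card_erase_of_mem hj]
    rw [h3, Finset.sum_insert (by simp [hj'.2]), Finset.insert_erase hj'.2, h4] at h2
    linear_combination h2
  rw [Finset.sum_congr rfl h1, Finset.sum_sub_distrib, ← Finset.mul_sum, h.down, Finset.sum_const,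
    nsmul_eq_mul]
  ring

/-- Erasing an element of `s` leaves the trace on `t` unchanged, so the two harmonicity scalars
multiply. -/
theorem sum_swap (hs : IsHarmonic s a φ) (ht : IsHarmonic t b φ) (hst : Disjoint s t)
    (z : Finset α) :
    ∑ j ∈ s ∩ z, ∑ k ∈ t \ z, φ (insert k (z.erase j))
      = (((t.card : ℂ) - (t ∩ z).card - b) * (((s ∩ z).card : ℂ) - a)) * φ z := by
  have h1 : ∀ j ∈ s ∩ z, ∑ k ∈ t \ z, φ (insert k (z.erase j))
      = ((t.card : ℂ) - (t ∩ z).card - b) * φ (z.erase j) := by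
    intro j hj
    have hj' : j ∉ t := Finset.disjoint_left.1 hst (Finset.mem_inter.1 hj).1
    have h2 := ht.up (z.erase j)
    have h3 : t \ z.erase j = t \ z := by
      ext k
      simp only [Finset.mem_sdiff, Finset.mem_erase]
      by_cases hk : k = j
      · subst hk; simp [hj']
      · simp [hk]
    have h4 : t ∩ z.erase j = t ∩ z := by
      rw [Finset.inter_erase, Finset.erase_eq_of_notMem (by simp [hj'])]
    rwa [h3, h4] at h2
  rw [Finset.sum_congr rfl h1, ← Finset.mul_sum, hs.down]
  ring

end IsHarmonic

end Harmonic

/-! ### Ladders after deleting the edges inside levels -/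

section FullGraph

variable {X : Type*} [Fintype X] [DecidableEq X] {G : SimpleGraph X} {x : X} {φ : X → ℂ}
  {c : ℕ → ℕ → ℂ}

theorem IsLadder.fullGraph (h : IsLadder G x φ c)
    (hd : ∀ y, (fullGraph G x).dist x y = G.dist x y) :
    IsLadder (fullGraph G x) x φ (fun i j => if i = j then 0 else c i j) := by
  classical
  intro j y
  have hE : dualIdempotent (UniformStructure.fullGraph G x) x j = dualIdempotent G x j := by
    simp only [dualIdempotent, hd]
  rw [hE, hd]
  have h1 : ∀ z, adjacency (UniformStructure.fullGraph G x) y z * (dualIdempotent G x j *ᵥ φ) z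
      = if G.dist x y = j then 0 else adjacency G y z * (dualIdempotent G x j *ᵥ φ) z := by
    intro z
    rw [dualIdempotent_mulVec_apply]
    simp only [adjacency, SimpleGraph.adjMatrix_apply]
    have : (UniformStructure.fullGraph G x).Adj y z ↔ G.Adj y z ∧ G.dist x y ≠ G.dist x z :=
      Iff.rfl
    by_cases hz : G.dist x z = j
    · by_cases hyj : G.dist x y = j
      · simp [this, hz, hyj]
      · simp [this, hz, hyj]
    · simp [hz]
  have h2 := h j y
  rw [Matrix.mulVec, dotProduct] at h2 ⊢
  rw [Finset.sum_congr rfl fun z _ => h1 z]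
  by_cases hyj : G.dist x y = j
  · simp [hyj]
  · simp only [if_neg hyj]
    exact h2

end FullGraph

/-! ### Distances and ladder coefficients in the Johnson graph -/

section Johnson

variable {n D : ℕ}

/-- The number of elements of `y` outside `x`; this is the distance from `x` to `y`. -/
def level (x y : JohnsonVertex n D) : ℕ := (x.1ᶜ ∩ y.1).card

theorem card_inter_add_level (x y : JohnsonVertex n D) : (x.1 ∩ y.1).card + level x y = D := by
  have h : x.1ᶜ ∩ y.1 = y.1 \ x.1 := by
    ext k
    simp [and_comm]
  rw [level, h, Finset.inter_comm, Finset.card_inter_add_card_sdiff, y.2]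

theorem level_eq_zero_iff (x y : JohnsonVertex n D) : level x y = 0 ↔ y = x := by
  rw [level, Finset.card_eq_zero]
  constructor
  · intro h
    refine Subtype.ext (Finset.eq_of_subset_of_card_le (fun k hk => ?_) (by rw [x.2, y.2]))
    by_contra hx
    have : k ∈ x.1ᶜ ∩ y.1 := by simp [hx, hk]
    simp [h] at this
  · rintro rfl
    ext k
    simp

/-- Replace the element `j` of `y` by the element `k` outside `y`. -/
def swap (y : JohnsonVertex n D) {j k : Fin n} (hj : j ∈ y.1) (hk : k ∉ y.1) :
    JohnsonVertex n D :=
  ⟨insert k (y.1.erase j), by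
    have := Finset.card_pos.2 ⟨j, hj⟩
    rw [Finset.card_insert_of_notMem (by simp [hk]), Finset.card_erase_of_mem hj, y.2]
    rw [y.2] at this
    omega⟩

theorem swap_adj (y : JohnsonVertex n D) {j k : Fin n} (hj : j ∈ y.1) (hk : k ∉ y.1) :
    (johnson n D).Adj y (swap y hj hk) := by
  show (y.1 ∩ insert k (y.1.erase j)).card + 1 = D
  have := Finset.card_pos.2 ⟨j, hj⟩
  rw [Finset.inter_insert_of_notMem hk, Finset.inter_erase, Finset.inter_self,
    Finset.card_erase_of_mem hj]
  rw [y.2] at this ⊢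
  omega

theorem exists_swap_of_adj {y z : JohnsonVertex n D} (h : (johnson n D).Adj y z) :
    ∃ (j k : Fin n) (hj : j ∈ y.1) (hk : k ∉ y.1), swap y hj hk = z := by
  have h' : (y.1 ∩ z.1).card + 1 = D := h
  have h1 : (y.1 \ z.1).card = 1 := by
    have := Finset.card_inter_add_card_sdiff y.1 z.1
    rw [y.2] at this
    omega
  have h2 : (z.1 \ y.1).card = 1 := by
    have := Finset.card_inter_add_card_sdiff z.1 y.1
    rw [z.2, Finset.inter_comm] at this
    omega
  obtain ⟨j, hj⟩ := Finset.card_eq_one.1 h1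
  obtain ⟨k, hk⟩ := Finset.card_eq_one.1 h2
  have hjm : ∀ l, (l ∈ y.1 ∧ l ∉ z.1) ↔ l = j := fun l => by
    rw [← Finset.mem_sdiff, hj, Finset.mem_singleton]
  have hkm : ∀ l, (l ∈ z.1 ∧ l ∉ y.1) ↔ l = k := fun l => by
    rw [← Finset.mem_sdiff, hk, Finset.mem_singleton]
  refine ⟨j, k, ((hjm j).2 rfl).1, ((hkm k).2 rfl).2, Subtype.ext ?_⟩
  ext l
  have a1 := hjm l
  have a2 := hkm l
  simp only [swap, Finset.mem_insert, Finset.mem_erase]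
  tauto

/-- The extension by zero of a function on `D`-sets to all finite sets. -/
def extendZero (f : JohnsonVertex n D → ℂ) (z : Finset (Fin n)) : ℂ :=
  if h : z.card = D then f ⟨z, h⟩ else 0

theorem extendZero_coe (f : JohnsonVertex n D → ℂ) (y : JohnsonVertex n D) :
    extendZero f y.1 = f y := by
  rw [extendZero, dif_pos y.2]

/-- Each neighbour of `y` arises from exactly one pair of an element removed and an element added.
-/
theorem adjacency_johnson_mulVec (f : JohnsonVertex n D → ℂ) (y : JohnsonVertex n D) :
    (adjacency (johnson n D) *ᵥ f) y
      = ∑ j ∈ y.1, ∑ k ∈ y.1ᶜ, extendZero f (insert k (y.1.erase j)) := by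
  classical
  rw [adjacency, SimpleGraph.adjMatrix_mulVec_apply, ← Finset.sum_product']
  symm
  refine Finset.sum_bij
    (fun p hp => swap y (Finset.mem_product.1 hp).1
      (Finset.mem_compl.1 (Finset.mem_product.1 hp).2)) ?_ ?_ ?_ ?_
  · intro p hp
    rw [SimpleGraph.mem_neighborFinset]
    exact swap_adj _ _ _
  · rintro ⟨j, k⟩ hp ⟨j', k'⟩ hp' h
    obtain ⟨hj, hk⟩ := Finset.mem_product.1 hp
    obtain ⟨hj', hk'⟩ := Finset.mem_product.1 hp'
    simp only [Finset.mem_compl] at hj hk hj' hk'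
    have h1 : ∀ l, l ∈ insert k (y.1.erase j) ↔ l ∈ insert k' (y.1.erase j') := by
      intro l
      have := congrArg Subtype.val h
      simp only [swap] at this
      rw [this]
    simp only [Finset.mem_insert, Finset.mem_erase] at h1
    have hkk : k = k' := by
      have := (h1 k).1 (Or.inl rfl)
      tauto
    have hjj : j = j' := by
      by_contra hne
      have := (h1 j).2 (Or.inr ⟨hne, hj⟩)
      have hjk : j ≠ k := by rintro rfl; exact hk hj
      tauto
    rw [hkk, hjj]
  · intro z hz
    rw [SimpleGraph.mem_neighborFinset] at hz
    obtain ⟨j, k, hj, hk, h⟩ := exists_swap_of_adj hz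
    exact ⟨(j, k), Finset.mem_product.2 ⟨hj, Finset.mem_compl.2 hk⟩, h⟩
  · intro p hp
    exact extendZero_coe f (swap y _ _)

theorem level_swap (x y : JohnsonVertex n D) {j k : Fin n} (hj : j ∈ y.1) (hk : k ∉ y.1) :
    level x (swap y hj hk) + (if j ∈ x.1 then 0 else 1) = level x y + (if k ∈ x.1 then 0 else 1) := by
  simp only [level, swap]
  by_cases h1 : k ∈ x.1
  · rw [Finset.inter_insert_of_notMem (by simpa using h1), Finset.inter_erase, if_pos h1]
    by_cases h2 : j ∈ x.1
    · rw [Finset.erase_eq_of_notMem (by simp [h2]), if_pos h2]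
    · rw [if_neg h2, Finset.card_erase_add_one (by simp [h2, hj]), add_zero]
  · rw [Finset.inter_insert_of_mem (by simpa using h1), Finset.inter_erase, if_neg h1,
      Finset.card_insert_of_notMem (by simp [hk])]
    by_cases h2 : j ∈ x.1
    · rw [Finset.erase_eq_of_notMem (by simp [h2]), if_pos h2]
    · rw [if_neg h2, Finset.card_erase_add_one (by simp [h2, hj])]

theorem exists_adj_level_down (x y : JohnsonVertex n D) (h : level x y ≠ 0) :
    ∃ z, (johnson n D).Adj y z ∧ level x z + 1 = level x y := by
  have h1 : (x.1ᶜ ∩ y.1).Nonempty := Finset.card_ne_zero.1 h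
  have h2 : (x.1 \ y.1).Nonempty := by
    rw [← Finset.card_ne_zero]
    have := Finset.card_inter_add_card_sdiff x.1 y.1
    have := card_inter_add_level x y
    have := x.2
    omega
  obtain ⟨j, hj⟩ := h1
  obtain ⟨k, hk⟩ := h2
  simp only [Finset.mem_inter, Finset.mem_compl, Finset.mem_sdiff] at hj hk
  refine ⟨swap y hj.2 hk.2, swap_adj _ _ _, ?_⟩
  have := level_swap x y hj.2 hk.2
  simpa [hj.1, hk.1] using this

theorem level_le_of_adj (x : JohnsonVertex n D) {y z : JohnsonVertex n D}
    (h : (johnson n D).Adj y z) : level x z ≤ level x y + 1 := by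
  obtain ⟨j, k, hj, hk, rfl⟩ := exists_swap_of_adj h
  have := level_swap x y hj hk
  split_ifs at this <;> omega

theorem johnson_dist (x y : JohnsonVertex n D) : (johnson n D).dist x y = level x y :=
  dist_eq_of_level (level x) (level_eq_zero_iff x) (fun _ _ => level_le_of_adj x)
    (exists_adj_level_down x) y

theorem fullGraph_johnson_dist (x y : JohnsonVertex n D) :
    (fullGraph (johnson n D) x).dist x y = level x y := by
  refine dist_eq_of_level (level x) (level_eq_zero_iff x) (fun y z (h : _ ∧ _) => level_le_of_adj x h.1)
    (fun y hy => ?_) y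
  obtain ⟨z, hz, hl⟩ := exists_adj_level_down x y hy
  refine ⟨z, ⟨hz, ?_⟩, hl⟩
  rw [johnson_dist, johnson_dist]
  omega

/-- The ladder coefficients of functions that are harmonic of degree `a` on `x` and `b` on `xᶜ`. -/
def johnsonCoeff (n D a b : ℕ) (i j : ℕ) : ℂ :=
  if j = i then
    (((i : ℂ) + 1 - a) * ((D : ℂ) - i - a) - ((D : ℂ) - i))
      + (((n : ℂ) - D - i + 1 - b) * ((i : ℂ) - b) - i)
  else if j = i + 1 then ((n : ℂ) - D - i - b) * ((D : ℂ) - i - a)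
  else if i = j + 1 then ((i : ℂ) - a) * ((i : ℂ) - b)
  else 0

/-- Restriction of a function on finite sets to the vertices of the Johnson graph. -/
def restrict (n D : ℕ) (φ : Finset (Fin n) → ℂ) : JohnsonVertex n D → ℂ := fun y => φ y.1

theorem sum_sum_split {M : Type*} [AddCommMonoid M] (x y : Finset (Fin n)) (F : Fin n → Fin n → M) :
    ∑ j ∈ y, ∑ k ∈ yᶜ, F j k
      = ((∑ j ∈ x ∩ y, ∑ k ∈ x \ y, F j k) + ∑ j ∈ x ∩ y, ∑ k ∈ xᶜ \ y, F j k)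
        + ((∑ j ∈ xᶜ ∩ y, ∑ k ∈ x \ y, F j k) + ∑ j ∈ xᶜ ∩ y, ∑ k ∈ xᶜ \ y, F j k) := by
  have h1 : y = (x ∩ y) ∪ (xᶜ ∩ y) := by
    rw [← Finset.union_inter_distrib_right, Finset.union_compl, Finset.univ_inter]
  have h2 : yᶜ = (x \ y) ∪ (xᶜ \ y) := by
    rw [← Finset.union_sdiff_distrib, Finset.union_compl, Finset.compl_eq_univ_sdiff]
  have d1 : Disjoint (x ∩ y) (xᶜ ∩ y) :=
    Finset.disjoint_of_subset_left Finset.inter_subset_left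
      (Finset.disjoint_of_subset_right Finset.inter_subset_left disjoint_compl_right)
  have d2 : Disjoint (x \ y) (xᶜ \ y) :=
    Finset.disjoint_of_subset_left Finset.sdiff_subset
      (Finset.disjoint_of_subset_right Finset.sdiff_subset disjoint_compl_right)
  have h3 : ∀ f : Fin n → M, ∑ k ∈ yᶜ, f k = ∑ k ∈ x \ y, f k + ∑ k ∈ xᶜ \ y, f k := by
    intro f
    rw [← Finset.sum_union d2, ← h2]
  have h4 : ∀ f : Fin n → M, ∑ k ∈ y, f k = ∑ k ∈ x ∩ y, f k + ∑ k ∈ xᶜ ∩ y, f k := by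
    intro f
    rw [← Finset.sum_union d1, ← h1]
  rw [h4]
  simp only [h3, Finset.sum_add_distrib]

/-- Swaps are sorted by the sides of the removed and the inserted element. A swap within one side
keeps the level, a swap across sides changes it by one; on each of the four classes the level
projection is a constant factor and harmonicity evaluates the sum. -/
theorem isLadder_restrict {x : JohnsonVertex n D} {a b : ℕ} {φ : Finset (Fin n) → ℂ}
    (hx : IsHarmonic x.1 a φ) (hx' : IsHarmonic x.1ᶜ b φ) :
    IsLadder (johnson n D) x (restrict n D φ) (johnsonCoeff n D a b) := by
  intro i y
  have hDn : D ≤ n := by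
    rw [← x.2]
    exact (Finset.card_le_univ _).trans_eq (Fintype.card_fin n)
  have hE : ∀ {j k : Fin n} (hj : j ∈ y.1) (hk : k ∉ y.1),
      extendZero (dualIdempotent (johnson n D) x i *ᵥ restrict n D φ) (insert k (y.1.erase j))
        = (if level x y + (if k ∈ x.1 then 0 else 1) = i + (if j ∈ x.1 then 0 else 1) then 1 else 0)
          * φ (insert k (y.1.erase j)) := by
    intro j k hj hk
    have h1 := extendZero_coe (dualIdempotent (johnson n D) x i *ᵥ restrict n D φ) (swap y hj hk)
    have h2 : (swap y hj hk).1 = insert k (y.1.erase j) := rfl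
    rw [h2] at h1
    rw [h1, dualIdempotent_mulVec_apply, johnson_dist, ← level_swap x y hj hk, restrict, h2]
    simp only [Nat.add_right_cancel_iff]
    split_ifs <;> simp
  rw [adjacency_johnson_mulVec, sum_sum_split x.1, johnson_dist]
  have hF : ∀ (s t : Finset (Fin n)) (u v : ℕ),
      (∀ j ∈ s, (if j ∈ x.1 then 0 else 1) = u) → (∀ k ∈ t, (if k ∈ x.1 then 0 else 1) = v) →
      ∑ j ∈ s ∩ y.1, ∑ k ∈ t \ y.1, extendZero
        (dualIdempotent (johnson n D) x i *ᵥ restrict n D φ) (insert k (y.1.erase j))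
      = (if level x y + v = i + u then 1 else 0)
        * ∑ j ∈ s ∩ y.1, ∑ k ∈ t \ y.1, φ (insert k (y.1.erase j)) := by
    intro s t u v hu hv
    rw [Finset.mul_sum]
    refine Finset.sum_congr rfl fun j hj => ?_
    rw [Finset.mul_sum]
    refine Finset.sum_congr rfl fun k hk => ?_
    rw [Finset.mem_inter] at hj
    rw [Finset.mem_sdiff] at hk
    rw [hE hj.2 hk.2, hu j hj.1, hv k hk.1]
  have u0 : ∀ j ∈ x.1, (if j ∈ x.1 then 0 else 1) = 0 := fun j hj => if_pos hj
  have u1 : ∀ j ∈ x.1ᶜ, (if j ∈ x.1 then 0 else 1) = 1 :=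
    fun j hj => if_neg (Finset.mem_compl.1 hj)
  rw [hF _ _ 0 0 u0 u0, hF _ _ 0 1 u0 u1, hF _ _ 1 0 u1 u0, hF _ _ 1 1 u1 u1,
    hx.sum_swap_self, hx'.sum_swap_self, hx.sum_swap hx' disjoint_compl_right,
    hx'.sum_swap hx disjoint_compl_left]
  have e1 : ((x.1 ∩ y.1).card : ℂ) = D - level x y := by
    have := congrArg (Nat.cast : ℕ → ℂ) (card_inter_add_level x y)
    push_cast at this
    linear_combination this
  have e2 : (x.1ᶜ ∩ y.1).card = level x y := rfl
  have e3 : (x.1ᶜ.card : ℂ) = n - D := by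
    rw [Finset.card_compl, x.2, Fintype.card_fin, Nat.cast_sub hDn]
  rw [e1, e2, e3, x.2, johnsonCoeff, restrict]
  generalize level x y = l
  by_cases h1 : i = l
  · subst h1
    simp
    ring
  · by_cases h2 : i = l + 1
    · subst h2
      simp [show ¬ l = l + 1 + 1 by omega]
    · by_cases h3 : l = i + 1
      · subst h3
        simp [show ¬ i + 1 + 1 = i by omega, show ¬ i = i + 1 + 1 by omega]
      · simp [h1, h2, h3, show ¬ l = i by omega, show ¬ l + 1 = i by omega]

theorem isLadder_fullGraph_restrict {x : JohnsonVertex n D} {a b : ℕ} {φ : Finset (Fin n) → ℂ}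
    (hx : IsHarmonic x.1 a φ) (hx' : IsHarmonic x.1ᶜ b φ) :
    IsLadder (fullGraph (johnson n D) x) x (restrict n D φ)
      (fun i j => if i = j then 0 else johnsonCoeff n D a b i j) :=
  (isLadder_restrict hx hx').fullGraph fun y => by
    rw [fullGraph_johnson_dist, johnson_dist]

end Johnson

/-! ### Supports of harmonic functions and the absence of a uniform structure -/

section Johnson

variable {n D : ℕ} {x : JohnsonVertex n D} {a b : ℕ} {φ : Finset (Fin n) → ℂ}

theorem johnsonCoeff_self_succ (n D a b i : ℕ) :
    johnsonCoeff n D a b i (i + 1) = ((n : ℂ) - D - i - b) * ((D : ℂ) - i - a) := by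
  simp [johnsonCoeff]

theorem johnsonCoeff_succ_self (n D a b i : ℕ) :
    johnsonCoeff n D a b (i + 1) i = ((i : ℂ) + 1 - a) * ((i : ℂ) + 1 - b) := by
  simp [johnsonCoeff, show ¬ i = i + 1 + 1 by omega]

theorem johnsonCoeff_self_succ_ne_zero {n D a b i : ℕ} (ha : i + a < D) (hb : D + i + b < n) :
    johnsonCoeff n D a b i (i + 1) ≠ 0 := by
  rw [johnsonCoeff_self_succ]
  obtain ⟨k, rfl⟩ := Nat.exists_eq_add_of_lt ha
  obtain ⟨l, rfl⟩ := Nat.exists_eq_add_of_lt hb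
  have h1 : ((k + 1 : ℕ) : ℂ) ≠ 0 := Nat.cast_ne_zero.2 (by omega)
  have h2 : ((l + 1 : ℕ) : ℂ) ≠ 0 := Nat.cast_ne_zero.2 (by omega)
  convert mul_ne_zero h2 h1 using 2 <;> push_cast <;> ring

theorem johnsonCoeff_succ_self_ne_zero {n D a b i : ℕ} (ha : a ≤ i) (hb : b ≤ i) :
    johnsonCoeff n D a b (i + 1) i ≠ 0 := by
  rw [johnsonCoeff_succ_self]
  obtain ⟨k, rfl⟩ := Nat.exists_eq_add_of_le ha
  obtain ⟨l, hl⟩ := Nat.exists_eq_add_of_le hb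
  have h1 : ((k + 1 : ℕ) : ℂ) ≠ 0 := Nat.cast_ne_zero.2 (by omega)
  have h2 : ((l + 1 : ℕ) : ℂ) ≠ 0 := Nat.cast_ne_zero.2 (by omega)
  convert mul_ne_zero h1 h2 using 2
  · push_cast
    ring
  · rw [hl]
    push_cast
    ring

/-- A harmonic function that is nonzero somewhere on level one is nonzero somewhere on every later
level up to its natural bound. -/
theorem exists_level_ne_zero (hx : IsHarmonic x.1 a φ) (hx' : IsHarmonic x.1ᶜ b φ)
    (h1 : ∃ y, level x y = 1 ∧ restrict n D φ y ≠ 0) {i : ℕ} (hi : 1 ≤ i) :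
    i + a ≤ D → D + i + b ≤ n → ∃ y, level x y = i ∧ restrict n D φ y ≠ 0 := by
  induction i, hi using Nat.le_induction with
  | base => exact fun _ _ => h1
  | succ k hk ih =>
    intro ha hb
    obtain ⟨y, hy, hφ⟩ := ih (by omega) (by omega)
    -- At a vertex of level `k`, the vector `A E*ₖ₊₁ φ` is a nonzero multiple of `φ`. It would be
    -- zero if `φ` vanished on level `k + 1`.
    have h2 := isLadder_restrict hx hx' (k + 1) y
    rw [johnson_dist, hy] at h2
    by_contra hne
    have h3 : dualIdempotent (johnson n D) x (k + 1) *ᵥ restrict n D φ = 0 := by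
      ext z
      rw [dualIdempotent_mulVec_apply, johnson_dist]
      split_ifs with hz
      · by_contra hz'
        exact hne ⟨z, hz, hz'⟩
      · rfl
    rw [h3, Matrix.mulVec_zero, Pi.zero_apply] at h2
    exact mul_ne_zero (johnsonCoeff_self_succ_ne_zero (by omega) (by omega)) hφ h2.symm

/-- A function of degree one on a side vanishes on sets that contain or miss that side. This removes
level 0, and level `D` when `a = 1`. Because `n > 2D`, a `D`-set cannot cover the complement of `x`,
so `b` does not shorten the support. -/
theorem johnson_support_iff (hx : IsHarmonic x.1 a φ) (hx' : IsHarmonic x.1ᶜ b φ) (ha : a ≤ 1)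
    (hb : b ≤ 1) (hab : 1 ≤ a + b) (hn : 2 * D < n)
    (h1 : ∃ y, level x y = 1 ∧ restrict n D φ y ≠ 0) (i : ℕ) :
    (∃ y, (johnson n D).dist x y = i ∧ restrict n D φ y ≠ 0) ↔ i ∈ Finset.Icc 1 (D - a) := by
  simp only [johnson_dist]
  rw [Finset.mem_Icc]
  constructor
  · rintro ⟨y, hy, hφ⟩
    have hc := card_inter_add_level x y
    refine ⟨?_, ?_⟩
    · by_contra hi
      have hy0 : level x y = 0 := by omega
      obtain rfl := (level_eq_zero_iff x y).1 hy0
      apply hφ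
      obtain rfl | rfl : a = 1 ∨ b = 1 := by omega
      · exact hx.eq_zero_of_subset le_rfl
      · exact hx'.eq_zero_of_disjoint (Finset.card_eq_zero.1 hy0)
    · by_contra hi
      obtain rfl : a = 1 := by omega
      exact hφ (hx.eq_zero_of_disjoint (Finset.card_eq_zero.1 (by omega)))
  · rintro ⟨hi, hi'⟩
    have : 1 ≤ D := by
      obtain ⟨y, hy, -⟩ := h1
      have := card_inter_add_level x y
      omega
    exact exists_level_ne_zero hx hx' h1 hi (by omega) (by omega)

/-- The constant `1` for `a = 0`, the difference of the indicators of `j` and `j'` otherwise. -/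
def indicatorDiff {α : Type*} [DecidableEq α] (a : ℕ) (j j' : α) (z : Finset α) : ℂ :=
  if a = 0 then 1 else (if j ∈ z then 1 else 0) - (if j' ∈ z then 1 else 0)

theorem indicatorDiff_insert {α : Type*} [DecidableEq α] (a : ℕ) {j j' k : α} (hj : k ≠ j)
    (hj' : k ≠ j') (z : Finset α) :
    indicatorDiff a j j' (insert k z) = indicatorDiff a j j' z := by
  simp [indicatorDiff, hj.symm, hj'.symm]

theorem isHarmonic_indicatorDiff_mul {α : Type*} [DecidableEq α] {s : Finset α} {a : ℕ}
    (ha : a ≤ 1) {j j' : α} (hj : j ∈ s) (hj' : j' ∈ s) {v : Finset α → ℂ}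
    (hv : ∀ z, ∀ k ∈ s, v (insert k z) = v z) :
    IsHarmonic s a (fun z => indicatorDiff a j j' z * v z) := by
  obtain rfl | rfl : a = 0 ∨ a = 1 := by omega
  · refine isHarmonic_zero fun z k hk => ?_
    simp [indicatorDiff, hv z k hk]
  · refine isHarmonic_one
      (ψ := fun k z => (if j = k then v z else 0) - (if j' = k then v z else 0)) ?_ ?_ ?_
    · intro z
      rw [Finset.sum_sub_distrib, Finset.sum_ite_eq, Finset.sum_ite_eq]
      simp only [indicatorDiff, Finset.mem_inter, hj, hj', true_and]
      split_ifs <;> simp_all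
    · intro k z l hl
      simp only [hv z l hl]
    · intro z
      rw [Finset.sum_sub_distrib, Finset.sum_ite_eq, Finset.sum_ite_eq, if_pos hj, if_pos hj',
        sub_self]

theorem exists_isHarmonic (x : JohnsonVertex n D) (hD : 2 ≤ D) (hn : 2 * D ≤ n) (ha : a ≤ 1)
    (hb : b ≤ 1) :
    ∃ φ : Finset (Fin n) → ℂ, IsHarmonic x.1 a φ ∧ IsHarmonic x.1ᶜ b φ ∧
      ∃ y, level x y = 1 ∧ restrict n D φ y ≠ 0 := by
  obtain ⟨j, hj, j', hj', hne⟩ := Finset.one_lt_card.1 (by rw [x.2]; omega : 1 < x.1.card)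
  obtain ⟨k, hk, k', hk', hne'⟩ := Finset.one_lt_card.1
    (by rw [Finset.card_compl, x.2, Fintype.card_fin]; omega : 1 < x.1ᶜ.card)
  have hd : ∀ {l m}, l ∈ x.1 → m ∈ x.1ᶜ → l ≠ m := by
    rintro l m hl hm rfl
    exact Finset.mem_compl.1 hm hl
  refine ⟨fun z => indicatorDiff a j j' z * indicatorDiff b k k' z, ?_, ?_, ?_⟩
  · exact isHarmonic_indicatorDiff_mul ha hj hj' fun z l hl =>
      indicatorDiff_insert b (hd hl hk) (hd hl hk') z
  · simp only [mul_comm (indicatorDiff a j j' _)]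
    exact isHarmonic_indicatorDiff_mul hb hk hk' fun z l hl =>
      indicatorDiff_insert a (hd hj hl).symm (hd hj' hl).symm z
  · have hkx := Finset.mem_compl.1 hk
    -- This vertex contains `j` and `k` but neither `j'` nor `k'`, so both factors equal 1.
    refine ⟨swap x hj' hkx, ?_, ?_⟩
    · have := level_swap x x hj' hkx
      rw [if_pos hj', if_neg hkx, (level_eq_zero_iff x x).2 rfl] at this
      omega
    · simp only [restrict, swap]
      apply mul_ne_zero
      · simp [indicatorDiff, hne, hj, hd hj' hk]
      · have h2 : k' ∉ x.1 := Finset.mem_compl.1 hk'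
        simp [indicatorDiff, hne'.symm, h2]

theorem eccentricity_fullGraph_johnson (hn : 2 * D ≤ n) (x : JohnsonVertex n D) :
    eccentricity (fullGraph (johnson n D) x) x = D := by
  simp only [eccentricity, fullGraph_johnson_dist]
  apply le_antisymm
  · refine Finset.sup_le fun y _ => ?_
    have := card_inter_add_level x y
    omega
  · obtain ⟨y, hy, hc⟩ := Finset.exists_subset_card_eq
      (by rw [Finset.card_compl, x.2, Fintype.card_fin]; omega : D ≤ x.1ᶜ.card)
    have h1 : level x ⟨y, hc⟩ = D := by
      rw [level, Finset.inter_eq_right.2 hy, hc]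
    exact h1.symm.le.trans (Finset.le_sup (f := fun y => level x y) (Finset.mem_univ _))

/-- Put `N = n - D`, `gᵢ = (D - i)(i + 1)` and `hᵢ = (N - i)(i + 1)`. The product of the two
coefficients between levels `i` and `i + 1` is `(gᵢ - aD)(hᵢ - bN)` for `a, b ≤ 1`. It is affine in
each of `a` and `b`, so finite differences over the four choices separate the conditions on `U`. -/
theorem uniform_coefficients (hn : 2 * D ≤ n) {U : Matrix ℕ ℕ ℂ} {f : ℕ → ℂ}
    (hU : IsUniformStructure (fullGraph (johnson n D) x) x U f) {i : ℕ} (hi : i + 3 ≤ D) :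
    U (i + 2) (i + 1) + 1 + U (i + 2) (i + 3) = 0 ∧
    U (i + 2) (i + 3) * ((D : ℂ) - 2 * i - 4) = U (i + 2) (i + 1) * ((D : ℂ) - 2 * i - 2) ∧
    U (i + 2) (i + 3) * ((n : ℂ) - D - 2 * i - 4)
      = U (i + 2) (i + 1) * ((n : ℂ) - D - 2 * i - 2) := by
  have key : ∀ a b : ℕ, a ≤ 1 → b ≤ 1 →
      U (i + 2) (i + 1) * ((((n : ℂ) - D - i - b) * ((D : ℂ) - i - a))
          * (((i : ℂ) + 1 - a) * ((i : ℂ) + 1 - b)))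
      + (((n : ℂ) - D - (i + 1) - b) * ((D : ℂ) - (i + 1) - a))
          * (((i : ℂ) + 2 - a) * ((i : ℂ) + 2 - b))
      + U (i + 2) (i + 3) * ((((n : ℂ) - D - (i + 2) - b) * ((D : ℂ) - (i + 2) - a))
          * (((i : ℂ) + 3 - a) * ((i : ℂ) + 3 - b))) = f (i + 2) := by
    intro a b ha hb
    obtain ⟨φ, hx, hx', hφ⟩ := exists_isHarmonic x (by omega) hn ha hb
    have h1 := (isLadder_fullGraph_restrict hx hx').uniform_relation hU
      (i := i) (by rw [eccentricity_fullGraph_johnson hn]; exact hi)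
    have h2 : ∃ y, (fullGraph (johnson n D) x).dist x y = i + 1 ∧ restrict n D φ y ≠ 0 := by
      simp only [fullGraph_johnson_dist]
      exact exists_level_ne_zero hx hx' hφ (by omega) (by omega) (by omega)
    simp only [show i + 1 ≠ i + 2 by omega, show i + 2 ≠ i + 1 by omega,
      show i + 2 ≠ i + 3 by omega, show i + 3 ≠ i + 2 by omega, show i ≠ i + 1 by omega,
      show i + 1 ≠ i by omega, if_false] at h1
    have h3 := h1 (johnsonCoeff_self_succ_ne_zero (by omega) (by omega)) h2
    rw [johnsonCoeff_self_succ n D a b i, johnsonCoeff_self_succ n D a b (i + 1),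
      johnsonCoeff_self_succ n D a b (i + 2), johnsonCoeff_succ_self n D a b i,
      johnsonCoeff_succ_self n D a b (i + 1), johnsonCoeff_succ_self n D a b (i + 2)] at h3
    push_cast at h3
    linear_combination h3
  have k00 := key 0 0 (by omega) (by omega)
  have k10 := key 1 0 (by omega) (by omega)
  have k01 := key 0 1 (by omega) (by omega)
  have k11 := key 1 1 (by omega) (by omega)
  push_cast at k00 k10 k01 k11
  have hD0 : (D : ℂ) ≠ 0 := Nat.cast_ne_zero.2 (by omega)
  have hN0 : (n : ℂ) - D ≠ 0 := by
    rw [sub_ne_zero, Ne, Nat.cast_inj]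
    omega
  -- The mixed difference in `a` and `b` replaces every product by `D N`.
  have e1 : U (i + 2) (i + 1) + 1 + U (i + 2) (i + 3) = 0 := by
    apply (mul_eq_zero.1 (_ : (D : ℂ) * ((n : ℂ) - D) * _ = 0)).resolve_left
      (mul_ne_zero hD0 hN0)
    linear_combination k00 - k10 - k01 + k11
  refine ⟨e1, ?_, ?_⟩
  -- The difference in `b` leaves `N` times the relation for `gᵢ, gᵢ₊₁, gᵢ₊₂`. Subtracting `gᵢ₊₁`
  -- times `e1` turns it into one for the increments `D - 2i - 2` and `D - 2i - 4`. The difference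
  -- in `a` does the same for `hᵢ`.
  · apply mul_left_cancel₀ hN0
    linear_combination k00 - k01 - ((n : ℂ) - D) * (i + 2) * (D - i - 1) * e1
  · apply mul_left_cancel₀ hD0
    linear_combination k00 - k10 - (D : ℂ) * (i + 2) * (n - D - i - 1) * e1

/-- Johnson graphs do not support a uniform structure. -/
theorem not_supportsUniformStructure_johnson (hD : 3 ≤ D) (hn : 2 * D ≤ n)
    (x : JohnsonVertex n D) : ¬ SupportsUniformStructure (johnson n D) x := by
  rintro ⟨U, f, hU⟩
  rcases hn.eq_or_lt with hn' | hn'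
  · subst hn'
    obtain ⟨m, rfl | rfl⟩ := Nat.even_or_odd' D
    -- With `D = 2i + 4`, one increment of `g` vanishes in each of the rows `m` and `m + 1`. Row `m`
    -- then has a zero below the diagonal and row `m + 1` a zero above it, which refutes both
    -- alternatives of `off_diagonal`.
    · obtain ⟨i, rfl⟩ := Nat.exists_eq_add_of_le (show 2 ≤ m by omega)
      obtain ⟨-, h1, -⟩ := uniform_coefficients le_rfl hU (i := i) (by omega)
      obtain ⟨-, h2, -⟩ := uniform_coefficients le_rfl hU (i := i + 1) (by omega)
      push_cast at h1 h2
      have h1' : U (i + 2) (i + 1) = 0 := by linear_combination -h1 / 2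
      have h2' : U (i + 3) (i + 4) = 0 := by linear_combination -h2 / 2
      have hoff := hU.1.off_diagonal
      rw [eccentricity_fullGraph_johnson le_rfl] at hoff
      rcases hoff with h | h
      · exact h (i + 2) (Finset.mem_Icc.2 ⟨by omega, by omega⟩) h1'
      · exact h (i + 4) (Finset.mem_Icc.2 ⟨by omega, by omega⟩) h2'
    -- With `D = 2i + 3` the increments are 1 and -1, so the off-diagonal entries of the row cancel,
    -- whereas their sum should be -1.
    · obtain ⟨i, rfl⟩ := Nat.exists_eq_add_of_le (show 1 ≤ m by omega)
      obtain ⟨h0, h1, -⟩ := uniform_coefficients le_rfl hU (i := i) (by omega)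
      push_cast at h1
      exact one_ne_zero (by linear_combination h0 + h1 : (1 : ℂ) = 0)
  · obtain ⟨h0, h1, h2⟩ := uniform_coefficients hn hU (i := 0) (by omega)
    have hne : (n : ℂ) - 2 * D ≠ 0 := by
      rw [sub_ne_zero]
      exact_mod_cast hn'.ne'
    -- The conditions from `D` and from `n - D` differ by a multiple of `n - 2D`, so the two entries
    -- of row 2 are equal. Either condition then makes both zero, contradicting that their sum is
    -- -1.
    have h3 : U (0 + 2) (0 + 3) - U (0 + 2) (0 + 1) = 0 :=
      (mul_eq_zero.1 (by linear_combination h2 - h1 : ((n : ℂ) - 2 * D) *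
        (U (0 + 2) (0 + 3) - U (0 + 2) (0 + 1)) = 0)).resolve_left hne
    push_cast at h1
    exact one_ne_zero (by linear_combination h0 + h1 - ((D : ℂ) - 3) * h3 : (1 : ℂ) = 0)

end Johnson

/-! ### Eigenvalues and primitive idempotents -/

section Spectrum

theorem adjacency_isHermitian {X : Type*} (G : SimpleGraph X) : (adjacency G).IsHermitian := by
  classical
  ext y z
  simp [adjacency, SimpleGraph.adjMatrix_apply, Matrix.conjTranspose_apply, SimpleGraph.adj_comm]

variable {X : Type*} [Fintype X] [DecidableEq X] {G : SimpleGraph X}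

/-- The characteristic determinant is compatible with the embedding of the reals in the complex
numbers, so the real spectrum is detected by complex eigenvectors. -/
theorem mem_eigenvalues_iff (G : SimpleGraph X) (θ : ℝ) :
    θ ∈ eigenvalues G ↔ ∃ v : X → ℂ, v ≠ 0 ∧ adjacency G *ᵥ v = (θ : ℂ) • v := by
  classical
  have h1 : θ ∈ eigenvalues G ↔ (algebraMap ℝ (Matrix X X ℝ) θ - G.adjMatrix ℝ).det = 0 := by
    rw [eigenvalues, Set.Finite.mem_toFinset, spectrum.mem_iff, Matrix.isUnit_iff_isUnit_det,
      isUnit_iff_ne_zero, not_not]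
  have h2 : (algebraMap ℝ (Matrix X X ℝ) θ - G.adjMatrix ℝ).map (algebraMap ℝ ℂ)
      = algebraMap ℂ (Matrix X X ℂ) θ - adjacency G := by
    ext y z
    simp only [adjacency, Matrix.map_apply, Matrix.sub_apply, SimpleGraph.adjMatrix_apply,
      Matrix.algebraMap_matrix_apply]
    split_ifs <;> simp
  have h3 : (algebraMap ℝ (Matrix X X ℝ) θ - G.adjMatrix ℝ).det = 0
      ↔ (algebraMap ℂ (Matrix X X ℂ) θ - adjacency G).det = 0 := by
    rw [← h2, ← RingHom.mapMatrix_apply, ← RingHom.map_det]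
    simp
  rw [h1, h3, ← Matrix.exists_mulVec_eq_zero_iff]
  refine exists_congr fun v => and_congr_right fun _ => ?_
  rw [Matrix.sub_mulVec, Algebra.algebraMap_eq_smul_one, Matrix.smul_mulVec, Matrix.one_mulVec,
    sub_eq_zero, eq_comm]

theorem exists_sum_eigenvectors (G : SimpleGraph X) (w : X → ℂ) :
    ∃ (u : X → X → ℂ) (μ : X → ℝ), w = ∑ i, u i ∧
      ∀ i, adjacency G *ᵥ u i = (μ i : ℂ) • u i := by
  have hA := adjacency_isHermitian G
  refine ⟨fun i => (hA.eigenvectorBasis.repr (WithLp.toLp 2 w)) i •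
    (WithLp.ofLp (hA.eigenvectorBasis i)), hA.eigenvalues, ?_, fun i => ?_⟩
  · have := congrArg WithLp.ofLp (hA.eigenvectorBasis.sum_repr (WithLp.toLp 2 w))
    rw [WithLp.ofLp_sum] at this
    exact this.symm
  · have h1 := hA.mulVec_eigenvectorBasis i
    rw [Matrix.mulVec_smul, h1, smul_comm]
    rfl

theorem aeval_mulVec_of_eigenvector {M : Matrix X X ℂ} {v : X → ℂ} {μ : ℂ} (h : M *ᵥ v = μ • v)
    (p : Polynomial ℂ) : Polynomial.aeval M p *ᵥ v = p.eval μ • v := by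
  induction p using Polynomial.induction_on' with
  | add p q hp hq => rw [map_add, Matrix.add_mulVec, hp, hq, Polynomial.eval_add, add_smul]
  | monomial k r =>
    have hpow : ∀ k : ℕ, M ^ k *ᵥ v = μ ^ k • v := by
      intro k
      induction k with
      | zero => simp
      | succ k ih =>
        rw [pow_succ, ← Matrix.mulVec_mulVec, h, Matrix.mulVec_smul, ih, smul_smul, pow_succ']
    rw [Polynomial.aeval_monomial, Algebra.algebraMap_eq_smul_one, smul_mul_assoc, one_mul,
      Matrix.smul_mulVec, hpow, Polynomial.eval_monomial, smul_smul]

theorem primitiveIdempotent_mulVec_of_eigenvector {v : X → ℂ} {μ θ : ℝ} (hθ : θ ∈ eigenvalues G)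
    (h : adjacency G *ᵥ v = (μ : ℂ) • v) :
    primitiveIdempotent G θ *ᵥ v = if μ = θ then v else 0 := by
  by_cases hv : v = 0
  · simp [hv]
  have hμ : μ ∈ eigenvalues G := (mem_eigenvalues_iff G μ).2 ⟨v, hv, h⟩
  rw [primitiveIdempotent, aeval_mulVec_of_eigenvector h]
  split_ifs with hμθ
  · subst hμθ
    rw [Lagrange.eval_basis_self (Complex.ofReal_injective.injOn) hθ, one_smul]
  · rw [Lagrange.eval_basis_of_ne (v := fun η : ℝ => (η : ℂ)) (Ne.symm hμθ) hμ, zero_smul]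

theorem adjacency_mulVec_primitiveIdempotent {θ : ℝ} (hθ : θ ∈ eigenvalues G) (w : X → ℂ) :
    adjacency G *ᵥ (primitiveIdempotent G θ *ᵥ w) = (θ : ℂ) • (primitiveIdempotent G θ *ᵥ w) := by
  obtain ⟨u, μ, rfl, hu⟩ := exists_sum_eigenvectors G w
  rw [Matrix.mulVec_sum, Matrix.mulVec_sum, Finset.smul_sum]
  refine Finset.sum_congr rfl fun i _ => ?_
  rw [primitiveIdempotent_mulVec_of_eigenvector hθ (hu i)]
  split_ifs with h
  · rw [hu, h]
  · simp

theorem primitiveIdempotent_mem_terwilligerAlgebra (G : SimpleGraph X) (x : X) (θ : ℝ) :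
    primitiveIdempotent G θ ∈ terwilligerAlgebra G x :=
  Algebra.adjoin_mono (s := {adjacency G}) Set.subset_union_left
    (Polynomial.aeval_mem_adjoin_singleton ℂ (adjacency G))

end Spectrum

/-! ### Raising and lowering in the Boolean lattice -/

section BooleanLattice

variable {α : Type*} [Fintype α] [DecidableEq α]

/-- The lowering operator of the Boolean lattice. -/
def booleanDown (f : Finset α → ℂ) (z : Finset α) : ℂ := ∑ k ∈ zᶜ, f (insert k z)

/-- The raising operator of the Boolean lattice. -/
def booleanUp (f : Finset α → ℂ) (z : Finset α) : ℂ := ∑ j ∈ z, f (z.erase j)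

theorem booleanUp_booleanDown (f : Finset α → ℂ) (z : Finset α) :
    booleanUp (booleanDown f) z
      = z.card * f z + ∑ j ∈ z, ∑ k ∈ zᶜ, f (insert k (z.erase j)) := by
  have h : ∀ j ∈ z, booleanDown f (z.erase j) = f z + ∑ k ∈ zᶜ, f (insert k (z.erase j)) := by
    intro j hj
    rw [booleanDown, Finset.compl_erase, Finset.sum_insert (by simp [hj]), Finset.insert_erase hj]
  rw [booleanUp, Finset.sum_congr rfl h, Finset.sum_add_distrib, Finset.sum_const, nsmul_eq_mul]

/-- Both composites contain the same sum over swaps. They differ only in how often they return to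
`z`: once for each element outside it, or once for each element of it. -/
theorem booleanDown_booleanUp (f : Finset α → ℂ) (z : Finset α) :
    booleanDown (booleanUp f) z
      = booleanUp (booleanDown f) z + ((Fintype.card α : ℂ) - 2 * z.card) * f z := by
  have h : ∀ k ∈ zᶜ, booleanUp f (insert k z) = f z + ∑ j ∈ z, f (insert k (z.erase j)) := by
    intro k hk
    have hk' := Finset.mem_compl.1 hk
    rw [booleanUp, Finset.sum_insert hk', Finset.erase_insert hk']
    congr 1
    refine Finset.sum_congr rfl fun j hj => ?_
    rw [Finset.erase_insert_of_ne]
    rintro rfl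
    exact hk' hj
  rw [booleanUp_booleanDown, booleanDown, Finset.sum_congr rfl h, Finset.sum_add_distrib,
    Finset.sum_const, nsmul_eq_mul, Finset.sum_comm, Finset.card_compl,
    Nat.cast_sub (Finset.card_le_univ z)]
  ring

/-- The spectrum of `UD` on level `k` of the Boolean lattice, together with the number of times
that an eigenvector can be lowered. -/
theorem booleanUp_booleanDown_eigenvector (k : ℕ) :
    ∀ (f : Finset α → ℂ) (μ : ℂ), (∃ z, f z ≠ 0) → (∀ z, f z ≠ 0 → z.card = k) →
      (∀ z, booleanUp (booleanDown f) z = μ * f z) →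
      ∃ j ≤ k, μ = ((k : ℂ) - j) * ((Fintype.card α : ℂ) - j - k + 1) ∧
        ∃ z, z.card = j ∧ booleanDown^[k - j] f z ≠ 0 := by
  induction k with
  | zero =>
    rintro f μ ⟨z, hz⟩ hs hf
    obtain rfl := Finset.card_eq_zero.1 (hs z hz)
    have h1 := hf ∅
    rw [booleanUp, Finset.sum_empty, eq_comm, mul_eq_zero] at h1
    exact ⟨0, le_rfl, by simp [h1.resolve_right hz], ∅, rfl, hz⟩
  | succ k ih =>
    rintro f μ ⟨z, hz⟩ hs hf
    by_cases hg : ∃ z, booleanDown f z ≠ 0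
    · have hgs : ∀ z, booleanDown f z ≠ 0 → z.card = k := by
        intro z hz
        obtain ⟨l, hl, hl'⟩ := Finset.exists_ne_zero_of_sum_ne_zero hz
        have := hs _ hl'
        rw [Finset.card_insert_of_notMem (Finset.mem_compl.1 hl)] at this
        omega
      -- By the commutation relation on level `k`, the lowered function is again an eigenvector of
      -- `UD`, with eigenvalue decreased by `|α| - 2k`.
      obtain ⟨j, hj, hμ, z', hz', hne⟩ := ih (booleanDown f)
        (μ - ((Fintype.card α : ℂ) - 2 * k)) hg hgs fun z => by
          have h1 := booleanDown_booleanUp (booleanDown f) z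
          have h2 : booleanDown (booleanUp (booleanDown f)) z = μ * booleanDown f z := by
            rw [booleanDown, booleanDown, Finset.mul_sum]
            exact Finset.sum_congr rfl fun l _ => hf _
          rw [h2] at h1
          by_cases hz : booleanDown f z = 0
          · rw [hz] at h1 ⊢
            linear_combination -h1
          · rw [hgs z hz] at h1
            linear_combination -h1
      refine ⟨j, by omega, ?_, z', hz', ?_⟩
      · push_cast
        linear_combination hμ
      · rwa [show k + 1 - j = (k - j) + 1 by omega, Function.iterate_succ_apply]
    -- If lowering kills `f`, the eigenvalue is 0 and no lowering is needed: `j = k + 1`.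
    · push Not at hg
      refine ⟨k + 1, le_rfl, ?_, z, hs z hz, by simpa using hz⟩
      have h1 := hf z
      rw [booleanUp, Finset.sum_eq_zero fun l _ => hg _, eq_comm, mul_eq_zero] at h1
      rw [h1.resolve_right hz, sub_self, zero_mul]

/-- Lowering inserts an element on one side, which raises one of the two counts by one, and
harmonicity returns a multiple of `φ`. So multiples of `φ` by functions of the counts are stable,
and an iterate can be nonzero at `z` only if `φ z ≠ 0`. -/
theorem IsHarmonic.booleanDown_iterate {s : Finset α} {a b : ℕ} {φ : Finset α → ℂ}
    (hs : IsHarmonic s a φ) (hs' : IsHarmonic sᶜ b φ) (m : ℕ) :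
    ∀ r : ℕ → ℕ → ℂ, ∃ r' : ℕ → ℕ → ℂ, ∀ z,
      booleanDown^[m] (fun z => r (s ∩ z).card (sᶜ ∩ z).card * φ z) z
        = r' (s ∩ z).card (sᶜ ∩ z).card * φ z := by
  induction m with
  | zero => exact fun r => ⟨r, fun z => rfl⟩
  | succ m ih =>
    intro r
    have h : booleanDown (fun z => r (s ∩ z).card (sᶜ ∩ z).card * φ z)
        = fun z => (r ((s ∩ z).card + 1) (sᶜ ∩ z).card * ((s.card : ℂ) - (s ∩ z).card - a)
          + r (s ∩ z).card ((sᶜ ∩ z).card + 1) * ((sᶜ.card : ℂ) - (sᶜ ∩ z).card - b)) * φ z := by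
      ext z
      have h2 : zᶜ = (s \ z) ∪ (sᶜ \ z) := by
        rw [← Finset.union_sdiff_distrib, Finset.union_compl, Finset.compl_eq_univ_sdiff]
      have d2 : Disjoint (s \ z) (sᶜ \ z) :=
        Finset.disjoint_of_subset_left Finset.sdiff_subset
          (Finset.disjoint_of_subset_right Finset.sdiff_subset disjoint_compl_right)
      rw [booleanDown, h2, Finset.sum_union d2, add_mul, mul_assoc, mul_assoc, ← hs.up, ← hs'.up,
        Finset.mul_sum, Finset.mul_sum]
      congr 1
      · refine Finset.sum_congr rfl fun k hk => ?_
        rw [Finset.mem_sdiff] at hk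
        rw [Finset.inter_insert_of_mem hk.1, Finset.inter_insert_of_notMem (by simp [hk.1]),
          Finset.card_insert_of_notMem (by simp [hk.2])]
      · refine Finset.sum_congr rfl fun k hk => ?_
        rw [Finset.mem_sdiff] at hk
        rw [Finset.inter_insert_of_mem hk.1,
          Finset.inter_insert_of_notMem (by simpa using hk.1),
          Finset.card_insert_of_notMem (by simp [hk.2])]
    simp only [Function.iterate_succ_apply]
    rw [h]
    exact ih fun p q => r (p + 1) q * ((s.card : ℂ) - p - a) + r p (q + 1) * ((sᶜ.card : ℂ) - q - b)

end BooleanLattice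

/-! ### The spectrum of the Johnson graph and dual endpoints -/

section Johnson

variable {n D : ℕ} {x : JohnsonVertex n D} {a b : ℕ} {φ : Finset (Fin n) → ℂ}

/-- The eigenvalues of the Johnson graph in decreasing order. -/
def johnsonEigenvalue (n D j : ℕ) : ℝ := ((D : ℝ) - j) * ((n : ℝ) - D - j) - j

theorem johnsonEigenvalue_lt (hn : 2 * D ≤ n) {j k : ℕ} (hjk : j < k) (hk : k ≤ D) :
    johnsonEigenvalue n D k < johnsonEigenvalue n D j := by
  have h1 : (0 : ℝ) < k - j := sub_pos.2 (by exact_mod_cast hjk)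
  have h2 : (0 : ℝ) < n + 1 - j - k := by
    have : ((j + k : ℕ) : ℝ) < (n + 1 : ℕ) := Nat.cast_lt.2 (by omega)
    push_cast at this
    linarith
  rw [johnsonEigenvalue, johnsonEigenvalue]
  linear_combination mul_pos h1 h2

/-- On functions supported on `D`-sets the Boolean operator `UD` is `A + D`, so the spectrum of `UD`
applies with eigenvalue `θ + D`. -/
theorem johnson_eigenvector {f : JohnsonVertex n D → ℂ} (hf : f ≠ 0) {θ : ℝ}
    (h : adjacency (johnson n D) *ᵥ f = (θ : ℂ) • f) :
    ∃ j ≤ D, θ = johnsonEigenvalue n D j ∧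
      ∃ z, z.card = j ∧ booleanDown^[D - j] (extendZero f) z ≠ 0 := by
  have hs : ∀ z, extendZero f z ≠ 0 → z.card = D := by
    intro z hz
    by_contra hc
    exact hz (by rw [extendZero, dif_neg hc])
  obtain ⟨y, hy⟩ := Function.ne_iff.1 hf
  obtain ⟨j, hj, hμ, hz⟩ := booleanUp_booleanDown_eigenvector D (extendZero f) (θ + D)
    ⟨y.1, by rwa [extendZero_coe]⟩ hs fun z => by
      rw [booleanUp_booleanDown]
      by_cases hz : z.card = D
      · have h1 := congrFun h ⟨z, hz⟩
        rw [adjacency_johnson_mulVec, Pi.smul_apply, smul_eq_mul] at h1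
        have h2 : extendZero f z = f ⟨z, hz⟩ := by rw [extendZero, dif_pos hz]
        rw [h1, h2, hz]
        ring
      · have h0 : extendZero f z = 0 := by rw [extendZero, dif_neg hz]
        rw [h0, mul_zero, mul_zero, zero_add]
        refine Finset.sum_eq_zero fun j hj => Finset.sum_eq_zero fun k hk => ?_
        have := Finset.card_pos.2 ⟨j, hj⟩
        rw [extendZero, dif_neg]
        rw [Finset.card_insert_of_notMem (by simp [Finset.mem_compl.1 hk]),
          Finset.card_erase_of_mem hj]
        omega
  refine ⟨j, hj, ?_, hz⟩
  rw [Fintype.card_fin] at hμ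
  have : (θ : ℂ) = (johnsonEigenvalue n D j : ℝ) := by
    rw [johnsonEigenvalue]
    push_cast
    linear_combination hμ
  exact_mod_cast this

/-- Without a level projection the four swap sums simply add up, and the dependence on the level
cancels. -/
theorem adjacency_mulVec_restrict (hx : IsHarmonic x.1 a φ) (hx' : IsHarmonic x.1ᶜ b φ)
    (ha : a ≤ 1) (hb : b ≤ 1) :
    adjacency (johnson n D) *ᵥ restrict n D φ
      = (johnsonEigenvalue n D (a + b) : ℂ) • restrict n D φ := by
  have hDn : D ≤ n := by
    rw [← x.2]
    exact (Finset.card_le_univ _).trans_eq (Fintype.card_fin n)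
  ext y
  have hE : ∀ j ∈ y.1, ∀ k ∈ y.1ᶜ,
      extendZero (restrict n D φ) (insert k (y.1.erase j)) = φ (insert k (y.1.erase j)) :=
    fun j hj k hk => extendZero_coe (restrict n D φ) (swap y hj (Finset.mem_compl.1 hk))
  rw [adjacency_johnson_mulVec,
    Finset.sum_congr rfl fun j hj => Finset.sum_congr rfl fun k hk => hE j hj k hk,
    sum_sum_split x.1, hx.sum_swap_self, hx'.sum_swap_self, hx.sum_swap hx' disjoint_compl_right,
    hx'.sum_swap hx disjoint_compl_left]
  have e1 : ((x.1 ∩ y.1).card : ℂ) = D - level x y := by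
    have := congrArg (Nat.cast : ℕ → ℂ) (card_inter_add_level x y)
    push_cast at this
    linear_combination this
  have e2 : (x.1ᶜ ∩ y.1).card = level x y := rfl
  have e3 : (x.1ᶜ.card : ℂ) = n - D := by
    rw [Finset.card_compl, x.2, Fintype.card_fin, Nat.cast_sub hDn]
  rw [e1, e2, e3, x.2, Pi.smul_apply, restrict, johnsonEigenvalue, smul_eq_mul]
  obtain rfl | rfl : a = 0 ∨ a = 1 := by omega
  · obtain rfl | rfl : b = 0 ∨ b = 1 := by omega
    · push_cast; ring
    · push_cast; ring
  · obtain rfl | rfl : b = 0 ∨ b = 1 := by omega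
    · push_cast; ring
    · push_cast; ring

theorem johnsonEigenvalue_mem (hD : 2 ≤ D) (hn : 2 * D ≤ n) (x : JohnsonVertex n D) (ha : a ≤ 1)
    (hb : b ≤ 1) : johnsonEigenvalue n D (a + b) ∈ eigenvalues (johnson n D) := by
  obtain ⟨φ, hx, hx', y, -, hy⟩ := exists_isHarmonic x hD hn ha hb
  exact (mem_eigenvalues_iff _ _).2
    ⟨_, fun h => hy (congrFun h y), adjacency_mulVec_restrict hx hx' ha hb⟩

/-- All eigenvalues are among the decreasing values `θⱼ` with `j ≤ D`. For `t ≤ 2` those above `θₜ`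
have `j ≤ 1`, and these do occur because harmonic functions of total degree 0 and 1 exist. -/
theorem eigenvalueIndex_johnson (hD : 2 ≤ D) (hn : 2 * D ≤ n) (x : JohnsonVertex n D) {t : ℕ}
    (ht : t ≤ 2) : eigenvalueIndex (johnson n D) (johnsonEigenvalue n D t) = t := by
  have h1 : (eigenvalues (johnson n D)).filter (fun η => johnsonEigenvalue n D t < η)
      = (Finset.range t).image (johnsonEigenvalue n D) := by
    ext η
    simp only [Finset.mem_filter, Finset.mem_image, Finset.mem_range]
    constructor
    · rintro ⟨hη, hlt⟩
      obtain ⟨v, hv, hAv⟩ := (mem_eigenvalues_iff _ _).1 hη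
      obtain ⟨j, hj, rfl, -⟩ := johnson_eigenvector hv hAv
      refine ⟨j, ?_, rfl⟩
      by_contra hjt
      rcases (not_lt.1 hjt).eq_or_lt with h | h
      · rw [h] at hlt
        exact lt_irrefl _ hlt
      · exact lt_asymm hlt (johnsonEigenvalue_lt hn h hj)
    · rintro ⟨j, hj, rfl⟩
      refine ⟨?_, johnsonEigenvalue_lt hn hj (by omega)⟩
      obtain rfl | rfl : j = 0 ∨ j = 1 := by omega
      · exact johnsonEigenvalue_mem (a := 0) (b := 0) hD hn x (by omega) (by omega)
      · exact johnsonEigenvalue_mem (a := 1) (b := 0) hD hn x (by omega) (by omega)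
  rw [eigenvalueIndex, h1, Finset.card_image_of_injOn, Finset.card_range]
  intro i hi j hj h
  simp only [Finset.coe_range, Set.mem_Iio] at hi hj
  rcases lt_trichotomy i j with hij | hij | hij
  · exact absurd h (johnsonEigenvalue_lt hn hij (by omega)).ne'
  · exact hij
  · exact absurd h (johnsonEigenvalue_lt hn hij (by omega)).ne

theorem le_eigenvalueIndex_johnson (hD : 2 ≤ D) (hn : 2 * D ≤ n) (x : JohnsonVertex n D) {j t : ℕ}
    (ht : t ≤ 2) (hj : j ≤ D) (htj : t ≤ j) :
    t ≤ eigenvalueIndex (johnson n D) (johnsonEigenvalue n D j) := by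
  have h := eigenvalueIndex_johnson hD hn x ht
  rw [← h, eigenvalueIndex, eigenvalueIndex]
  refine Finset.card_le_card (Finset.monotone_filter_right _ fun η _ hη => lt_of_le_of_lt ?_ hη)
  rcases htj.eq_or_lt with h | h
  · rw [h]
  · exact (johnsonEigenvalue_lt hn h hj).le

/-- An eigenvector inside the module of a harmonic function belongs to an eigenvalue with index
at least the total degree. -/
theorem le_of_eigenvector_mem_radialSpan (hx : IsHarmonic x.1 a φ) (hx' : IsHarmonic x.1ᶜ b φ)
    (ha : a ≤ 1) (hb : b ≤ 1) {f : JohnsonVertex n D → ℂ} (hf : f ≠ 0)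
    (hmem : f ∈ radialSpan (johnson n D) x (restrict n D φ)) {θ : ℝ}
    (h : adjacency (johnson n D) *ᵥ f = (θ : ℂ) • f) :
    ∃ j ≤ D, a + b ≤ j ∧ θ = johnsonEigenvalue n D j := by
  obtain ⟨j, hj, hθ, z, hz, hne⟩ := johnson_eigenvector hf h
  refine ⟨j, hj, ?_, hθ⟩
  obtain ⟨s, rfl⟩ := hmem
  have he : extendZero (radialMul (johnson n D) x (restrict n D φ) s)
      = fun z => (fun p q => if p + q = D then s q else 0) (x.1 ∩ z).card (x.1ᶜ ∩ z).card * φ z := by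
    ext z
    have hc : (x.1 ∩ z).card + (x.1ᶜ ∩ z).card = z.card := by
      rw [← Finset.card_union_of_disjoint, ← Finset.union_inter_distrib_right,
        Finset.union_compl, Finset.univ_inter]
      exact Finset.disjoint_of_subset_left Finset.inter_subset_left
        (Finset.disjoint_of_subset_right Finset.inter_subset_left disjoint_compl_right)
    simp only [hc]
    rw [extendZero]
    split_ifs with hz
    · rw [radialMul_apply, johnson_dist]
      rfl
    · rw [zero_mul]
  obtain ⟨r, hr⟩ := hx.booleanDown_iterate hx' (D - j) fun p q => if p + q = D then s q else 0
  rw [he, hr] at hne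
  have hφ : φ z ≠ 0 := right_ne_zero_of_mul hne
  have hc : (x.1 ∩ z).card + (x.1ᶜ ∩ z).card = z.card := by
    rw [← Finset.card_union_of_disjoint, ← Finset.union_inter_distrib_right,
      Finset.union_compl, Finset.univ_inter]
    exact Finset.disjoint_of_subset_left Finset.inter_subset_left
      (Finset.disjoint_of_subset_right Finset.inter_subset_left disjoint_compl_right)
  -- Since `φ z ≠ 0`, the set `z` must meet each side on which `φ` has degree one. Its size `j` is
  -- therefore at least `a + b`.
  have h1 : a ≤ (x.1 ∩ z).card := by
    by_contra hlt
    obtain rfl : a = 1 := by omega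
    exact hφ (hx.eq_zero_of_disjoint (Finset.card_eq_zero.1 (by omega)))
  have h2 : b ≤ (x.1ᶜ ∩ z).card := by
    by_contra hlt
    obtain rfl : b = 1 := by omega
    exact hφ (hx'.eq_zero_of_disjoint (Finset.card_eq_zero.1 (by omega)))
  omega

/-- The value `a + b` is attained by `φ` itself. Conversely a nonzero projection of a vector of the
module is an eigenvector that still lies in the module, to which the lower bound applies. -/
theorem dualEndpoint_radialSpan (hD : 2 ≤ D) (hn : 2 * D ≤ n) (hx : IsHarmonic x.1 a φ)
    (hx' : IsHarmonic x.1ᶜ b φ) (ha : a ≤ 1) (hb : b ≤ 1) (hφ : restrict n D φ ≠ 0) :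
    dualEndpoint (johnson n D) (radialSpan (johnson n D) x (restrict n D φ)) = a + b := by
  have hmem : a + b ∈ {i | ∃ θ ∈ eigenvalues (johnson n D), eigenvalueIndex (johnson n D) θ = i ∧
      ∃ w ∈ radialSpan (johnson n D) x (restrict n D φ),
        primitiveIdempotent (johnson n D) θ *ᵥ w ≠ 0} := by
    have hθ := johnsonEigenvalue_mem hD hn x ha hb
    refine ⟨_, hθ, eigenvalueIndex_johnson hD hn x (by omega), _, self_mem_radialSpan _, ?_⟩
    rwa [primitiveIdempotent_mulVec_of_eigenvector hθ (adjacency_mulVec_restrict hx hx' ha hb),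
      if_pos rfl]
  apply le_antisymm (Nat.sInf_le hmem)
  refine le_csInf ⟨_, hmem⟩ ?_
  rintro i ⟨θ, hθ, rfl, w, hw, hne⟩
  obtain ⟨j, hj, hle, rfl⟩ := le_of_eigenvector_mem_radialSpan hx hx' ha hb hne
    ((isLadder_restrict hx hx').isTModule _
      (primitiveIdempotent_mem_terwilligerAlgebra _ x θ) w hw)
    (adjacency_mulVec_primitiveIdempotent hθ w)
  exact le_eigenvalueIndex_johnson hD hn x (by omega) hj hle

end Johnson

/-! ### A scalar invariant of ladder modules -/

section Modules

variable {X : Type*} [Fintype X] [DecidableEq X] {G : SimpleGraph X} {x : X} {φ φ' : X → ℂ}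
  {c c' : ℕ → ℕ → ℂ}

theorem IsTModule.inf {U W : Submodule ℂ (X → ℂ)} (hU : IsTModule G x U) (hW : IsTModule G x W) :
    IsTModule G x (U ⊓ W) :=
  fun B hB w hw => ⟨hU B hB w hw.1, hW B hB w hw.2⟩

/-- Isomorphic ladder modules have the same closed two-step coefficients. -/
theorem IsLadder.coeff_mul_eq_of_isTIsomorphic (h : IsLadder G x φ c) (h' : IsLadder G x φ' c')
    {i : ℕ} (j : ℕ) (hi : dualIdempotent G x i *ᵥ φ ≠ 0)
    (hσ : IsTIsomorphic G x (radialSpan G x φ) (radialSpan G x φ')) :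
    c j i * c i j = c' j i * c' i j := by
  obtain ⟨σ, hσ⟩ := hσ
  -- `B` walks from level `i` to level `j` and back. It acts as a scalar on the line spanned by `E*ᵢ
  -- φ`, and an isomorphism maps this line into the one spanned by `E*ᵢ φ'`.
  set B := dualIdempotent G x i * (adjacency G * (dualIdempotent G x j *
    (adjacency G * dualIdempotent G x i))) with hB
  have hBT : B ∈ terwilligerAlgebra G x :=
    mul_mem (dualIdempotent_mem_terwilligerAlgebra G x i) <|
      mul_mem (adjacency_mem_terwilligerAlgebra G x) <|
        mul_mem (dualIdempotent_mem_terwilligerAlgebra G x j) <|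
          mul_mem (adjacency_mem_terwilligerAlgebra G x)
            (dualIdempotent_mem_terwilligerAlgebra G x i)
  have hE : ∀ v : X → ℂ, dualIdempotent G x i *ᵥ (dualIdempotent G x i *ᵥ v)
      = dualIdempotent G x i *ᵥ v := by
    intro v
    ext y
    rw [dualIdempotent_mulVec_apply, dualIdempotent_mulVec_apply]
    split_ifs <;> rfl
  have hBφ : ∀ {ψ : X → ℂ} {d : ℕ → ℕ → ℂ}, IsLadder G x ψ d →
      B *ᵥ (dualIdempotent G x i *ᵥ ψ) = (d j i * d i j) • (dualIdempotent G x i *ᵥ ψ) := by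
    intro ψ d hd
    simp only [hB, ← Matrix.mulVec_mulVec]
    rw [hE, hd.dualIdempotent_adjacency, Matrix.mulVec_smul, Matrix.mulVec_smul,
      hd.dualIdempotent_adjacency, smul_smul]
  set w := dualIdempotent G x i *ᵥ φ with hw
  have hwmem : w ∈ radialSpan G x φ := dualIdempotent_mulVec_mem_radialSpan i φ
  set w' : X → ℂ := (σ ⟨w, hwmem⟩ : X → ℂ) with hw'
  have hw'0 : w' ≠ 0 := by
    intro h0
    have : σ ⟨w, hwmem⟩ = 0 := Subtype.ext h0
    rw [LinearEquiv.map_eq_zero_iff] at this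
    exact hi (congrArg Subtype.val this)
  have hEw' : dualIdempotent G x i *ᵥ w' = w' := by
    have hmem : dualIdempotent G x i *ᵥ w ∈ radialSpan G x φ := by rwa [hw, hE]
    rw [hw', ← hσ _ (dualIdempotent_mem_terwilligerAlgebra G x i) w hwmem hmem]
    congr 2
    exact Subtype.ext (hE φ)
  obtain ⟨s, hs⟩ := (σ ⟨w, hwmem⟩).2
  have hw's : w' = s i • (dualIdempotent G x i *ᵥ φ') := by
    rw [← hEw', ← dualIdempotent_mulVec_radialMul', hs]
  have h1 : B *ᵥ w' = (c' j i * c' i j) • w' := by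
    rw [hw's, Matrix.mulVec_smul, hBφ h', smul_comm]
  have h2 : B *ᵥ w' = (c j i * c i j) • w' := by
    have hmem : B *ᵥ w ∈ radialSpan G x φ := h.isTModule _ hBT _ hwmem
    rw [hw', ← hσ _ hBT w hwmem hmem]
    have : (⟨B *ᵥ w, hmem⟩ : radialSpan G x φ) = (c j i * c i j) • ⟨w, hwmem⟩ :=
      Subtype.ext (hBφ h)
    rw [this, map_smul]
    rfl
  exact smul_left_injective ℂ hw'0 (h2.symm.trans h1)

end Modules

/-! ### Harmonic functions from vectors and matrices with vanishing sums -/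

section Harmonic

variable {α : Type*} [DecidableEq α] {s t : Finset α}

theorem isHarmonic_one_sum {g : α → ℂ} (hg : ∑ j ∈ s, g j = 0) :
    IsHarmonic s 1 (fun z => ∑ j ∈ s ∩ z, g j) :=
  isHarmonic_one (ψ := fun k _ => g k) (fun _ => rfl) (fun _ _ _ _ => rfl) fun _ => hg

theorem isHarmonic_zero_sum (hst : Disjoint s t) (g : α → ℂ) :
    IsHarmonic t 0 (fun z => ∑ j ∈ s ∩ z, g j) :=
  isHarmonic_zero fun z k hk => by
    rw [Finset.inter_insert_of_notMem (Finset.disjoint_right.1 hst hk)]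

theorem isHarmonic_one_sum_sum (hst : Disjoint s t) {m : α → α → ℂ}
    (hm : ∀ k ∈ t, ∑ j ∈ s, m j k = 0) :
    IsHarmonic s 1 (fun z => ∑ j ∈ s ∩ z, ∑ k ∈ t ∩ z, m j k) := by
  refine isHarmonic_one (ψ := fun j z => ∑ k ∈ t ∩ z, m j k) (fun _ => rfl) ?_ ?_
  · intro k z j hj
    rw [Finset.inter_insert_of_notMem (Finset.disjoint_left.1 hst hj)]
  · intro z
    rw [Finset.sum_comm]
    exact Finset.sum_eq_zero fun k hk => hm k (Finset.mem_inter.1 hk).1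

end Harmonic

/-! ### Classification of the irreducible modules of endpoint one -/

section Johnson

variable {n D : ℕ} {x : JohnsonVertex n D} {a b : ℕ} {φ : Finset (Fin n) → ℂ}

/-- The value of `f` at the neighbour of `x` obtained by replacing `j` by `k`. -/
def neighborValue (x : JohnsonVertex n D) (f : JohnsonVertex n D → ℂ) (j k : Fin n) : ℂ :=
  extendZero f (insert k (x.1.erase j))

theorem neighborValue_eq (x : JohnsonVertex n D) (f : JohnsonVertex n D → ℂ) {j k : Fin n}
    (hj : j ∈ x.1) (hk : k ∉ x.1) : neighborValue x f j k = f (swap x hj hk) :=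
  extendZero_coe f (swap x hj hk)

theorem level_swap_base (x : JohnsonVertex n D) {j k : Fin n} (hj : j ∈ x.1) (hk : k ∉ x.1) :
    level x (swap x hj hk) = 1 := by
  have := level_swap x x hj hk
  rw [if_pos hj, if_neg hk, (level_eq_zero_iff x x).2 rfl] at this
  omega

theorem exists_swap_of_level_one {y : JohnsonVertex n D} (h : level x y = 1) :
    ∃ (j k : Fin n) (hj : j ∈ x.1) (hk : k ∉ x.1), swap x hj hk = y := by
  rw [← johnson_dist, SimpleGraph.dist_eq_one_iff_adj] at h
  exact exists_swap_of_adj h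

theorem eq_of_neighborValue_eq {u v : JohnsonVertex n D → ℂ}
    (hu : ∀ y, level x y ≠ 1 → u y = 0) (hv : ∀ y, level x y ≠ 1 → v y = 0)
    (h : ∀ j ∈ x.1, ∀ k ∉ x.1, neighborValue x u j k = neighborValue x v j k) : u = v := by
  ext y
  by_cases hy : level x y = 1
  · obtain ⟨j, k, hj, hk, rfl⟩ := exists_swap_of_level_one hy
    rw [← neighborValue_eq x u hj hk, ← neighborValue_eq x v hj hk, h j hj k hk]
  · rw [hu y hy, hv y hy]

theorem dualIdempotent_one_apply_of_level_ne (f : JohnsonVertex n D → ℂ) (y : JohnsonVertex n D)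
    (hy : level x y ≠ 1) : (dualIdempotent (johnson n D) x 1 *ᵥ f) y = 0 := by
  rw [dualIdempotent_mulVec_apply, johnson_dist, if_neg hy]

theorem neighborValue_dualIdempotent (f : JohnsonVertex n D → ℂ) {j k : Fin n}
    (hj : j ∈ x.1) (hk : k ∉ x.1) :
    neighborValue x (dualIdempotent (johnson n D) x 1 *ᵥ f) j k = neighborValue x f j k := by
  rw [neighborValue_eq x _ hj hk, neighborValue_eq x _ hj hk, dualIdempotent_mulVec_apply,
    johnson_dist, if_pos (level_swap_base x hj hk)]

theorem adjacency_mulVec_base (f : JohnsonVertex n D → ℂ) :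
    (adjacency (johnson n D) *ᵥ f) x = ∑ j ∈ x.1, ∑ k ∈ x.1ᶜ, neighborValue x f j k :=
  adjacency_johnson_mulVec f x

/-- The neighbours of `x` induce a rook's graph. -/
theorem neighborValue_adjacency {f : JohnsonVertex n D → ℂ} (hf : ∀ y, level x y ≠ 1 → f y = 0)
    {j k : Fin n} (hj : j ∈ x.1) (hk : k ∉ x.1) :
    neighborValue x (adjacency (johnson n D) *ᵥ f) j k
      = ∑ i ∈ x.1, neighborValue x f i k + ∑ l ∈ x.1ᶜ, neighborValue x f j l
        - 2 * neighborValue x f j k := by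
  have hne : j ≠ k := by
    rintro rfl
    exact hk hj
  have hext : ∀ z, (x.1ᶜ ∩ z).card ≠ 1 → extendZero f z = 0 := by
    intro z hz
    rw [extendZero]
    split_ifs with h
    · exact hf ⟨z, h⟩ hz
    · rfl
  have hcompl : (insert k (x.1.erase j))ᶜ = insert j (x.1ᶜ.erase k) := by
    ext l
    simp only [Finset.mem_compl, Finset.mem_insert, Finset.mem_erase]
    by_cases h : l = j
    · subst h; simp [hne]
    · simp [h]
  have hjn : j ∉ x.1ᶜ.erase k := by simp [hj]
  have hk' : k ∈ x.1ᶜ := by simpa using hk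
  rw [neighborValue_eq x _ hj hk, adjacency_johnson_mulVec]
  show ∑ i ∈ insert k (x.1.erase j), ∑ l ∈ (insert k (x.1.erase j))ᶜ,
    extendZero f (insert l ((insert k (x.1.erase j)).erase i)) = _
  rw [hcompl, Finset.sum_insert (by simp [hk])]
  have h1 : ∑ l ∈ insert j (x.1ᶜ.erase k),
      extendZero f (insert l ((insert k (x.1.erase j)).erase k))
        = ∑ l ∈ x.1ᶜ, neighborValue x f j l - neighborValue x f j k := by
    rw [Finset.erase_insert (by simp [hk]), Finset.sum_insert hjn, Finset.insert_erase hj,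
      hext x.1 (by rw [Finset.inter_comm, Finset.inter_compl]; simp), zero_add, ← Finset.add_sum_erase _ _ hk', add_sub_cancel_left]
    rfl
  have h2 : ∀ i ∈ x.1.erase j, ∑ l ∈ insert j (x.1ᶜ.erase k),
      extendZero f (insert l ((insert k (x.1.erase j)).erase i)) = neighborValue x f i k := by
    intro i hi
    rw [Finset.mem_erase] at hi
    have hik : k ≠ i := by
      rintro rfl
      exact hk hi.2
    rw [Finset.sum_insert hjn, Finset.sum_eq_zero, add_zero, neighborValue]
    · congr 1
      ext l
      simp only [Finset.mem_insert, Finset.mem_erase]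
      by_cases h : l = j
      · subst h; simp [hi.1.symm, hj]
      · by_cases h' : l = k
        · subst h'; simp [hik]
        · simp [h, h']
    · intro l hl
      simp only [Finset.mem_erase, Finset.mem_compl] at hl
      apply hext
      have hsub : ({k, l} : Finset (Fin n)) ⊆ x.1ᶜ ∩ insert l ((insert k (x.1.erase j)).erase i) := by
        intro r hr
        simp only [Finset.mem_insert, Finset.mem_singleton] at hr
        rcases hr with rfl | rfl
        · simp [hk, hik]
        · simp [hl.2]
      have := Finset.card_le_card hsub
      rw [Finset.card_pair hl.1.symm] at this
      omega
  rw [h1, Finset.sum_congr rfl h2, ← Finset.add_sum_erase _ _ hj]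
  ring

theorem neighborValue_restrict (φ : Finset (Fin n) → ℂ) {j k : Fin n} (hj : j ∈ x.1)
    (hk : k ∉ x.1) : neighborValue x (restrict n D φ) j k = φ (insert k (x.1.erase j)) :=
  neighborValue_eq x _ hj hk

theorem inter_swap {s : Finset (Fin n)} {j k : Fin n} (hk : k ∉ s) :
    s ∩ insert k (s.erase j) = s.erase j := by
  rw [Finset.inter_insert_of_notMem hk, Finset.inter_erase, Finset.inter_self]

theorem compl_inter_swap {s : Finset (Fin n)} {j k : Fin n} (hk : k ∉ s) :
    sᶜ ∩ insert k (s.erase j) = {k} := by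
  ext l
  by_cases h : l = k
  · subst h; simp [hk]
  · simp only [Finset.mem_inter, Finset.mem_compl, Finset.mem_insert, Finset.mem_erase,
      Finset.mem_singleton, h, false_or]
    tauto

/-- A `T`-module with endpoint one contains a vector `E*₁ φ ≠ 0` with `φ` harmonic. -/
theorem exists_harmonic_of_endpoint_one (hn : 2 * D < n) {W : Submodule ℂ (JohnsonVertex n D → ℂ)}
    (hW : IsTModule (johnson n D) x W) (hend : endpoint (johnson n D) x W = 1) :
    ∃ (a b : ℕ) (φ : Finset (Fin n) → ℂ), a ≤ 1 ∧ b ≤ 1 ∧ 1 ≤ a + b ∧ IsHarmonic x.1 a φ ∧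
      IsHarmonic x.1ᶜ b φ ∧ (∃ y, level x y = 1 ∧ restrict n D φ y ≠ 0) ∧
      dualIdempotent (johnson n D) x 1 *ᵥ restrict n D φ ∈ W := by
  have hDn : D ≤ n := by omega
  have h0 : ∀ v ∈ W, v x = 0 := by
    intro v hv
    by_contra hne
    have : 0 ∈ dualSupport (johnson n D) x W := by
      refine ⟨v, hv, fun h => hne ?_⟩
      have := congrFun h x
      rwa [dualIdempotent_mulVec_apply, SimpleGraph.dist_self, if_pos rfl] at this
    have := Nat.sInf_le this
    rw [endpoint] at hend
    omega
  obtain ⟨w₀, hw₀, hne⟩ : 1 ∈ dualSupport (johnson n D) x W := by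
    rw [← hend]
    exact Nat.sInf_mem (Nat.nonempty_of_pos_sInf (by rw [endpoint] at hend; omega))
  set E := dualIdempotent (johnson n D) x 1 with hE
  have hEmem : ∀ v ∈ W, E *ᵥ v ∈ W := hW _ (dualIdempotent_mem_terwilligerAlgebra _ x 1)
  have hAmem : ∀ v ∈ W, adjacency (johnson n D) *ᵥ v ∈ W :=
    hW _ (adjacency_mem_terwilligerAlgebra _ x)
  set w := E *ᵥ w₀ with hw
  have hwW : w ∈ W := hEmem _ hw₀
  have hw1 : ∀ y, level x y ≠ 1 → w y = 0 := dualIdempotent_one_apply_of_level_ne w₀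
  set m := neighborValue x w with hm
  set P : Fin n → ℂ := fun k => ∑ i ∈ x.1, m i k with hP
  set Q : Fin n → ℂ := fun j => ∑ l ∈ x.1ᶜ, m j l with hQ
  -- The total of the matrix `m` is the value of `A w` at `x`, which vanishes because the endpoint
  -- of `W` is 1.
  have hQ0 : ∑ j ∈ x.1, Q j = 0 := by
    rw [hQ, hm, ← adjacency_mulVec_base]
    exact h0 _ (hAmem _ hwW)
  have hP0 : ∑ k ∈ x.1ᶜ, P k = 0 := by
    rw [hP, Finset.sum_comm]
    exact hQ0
  have hadd : ∀ (u v : JohnsonVertex n D → ℂ) (r : ℂ) {j k : Fin n}, j ∈ x.1 → k ∉ x.1 →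
      neighborValue x (u + r • v) j k = neighborValue x u j k + r * neighborValue x v j k := by
    intro u v r j k hj hk
    simp only [neighborValue_eq x _ hj hk, Pi.add_apply, Pi.smul_apply, smul_eq_mul]
  have hsupp : ∀ (u v : JohnsonVertex n D → ℂ) (r : ℂ), (∀ y, level x y ≠ 1 → v y = 0) →
      ∀ y, level x y ≠ 1 → (E *ᵥ u + r • v) y = 0 := by
    intro u v r hv y hy
    rw [Pi.add_apply, Pi.smul_apply, hv y hy, hE, dualIdempotent_one_apply_of_level_ne u y hy,
      smul_zero, add_zero]
  -- Adding `2 w` cancels the term `-2 m` of the rook's graph, leaving the line sums `P k + Q j`.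
  set w₁ := E *ᵥ (adjacency (johnson n D) *ᵥ w) + (2 : ℂ) • w with hw₁
  have hw₁W : w₁ ∈ W := W.add_mem (hEmem _ (hAmem _ hwW)) (W.smul_mem _ hwW)
  have hw₁1 : ∀ y, level x y ≠ 1 → w₁ y = 0 := hsupp _ _ _ hw1
  have hm₁ : ∀ j ∈ x.1, ∀ k ∉ x.1, neighborValue x w₁ j k = P k + Q j := by
    intro j hj k hk
    rw [hw₁, hadd _ _ _ hj hk, hE, neighborValue_dualIdempotent _ hj hk,
      neighborValue_adjacency hw1 hj hk, ← hm]
    ring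
  have hcard : (x.1ᶜ.card : ℂ) = n - D := by
    rw [Finset.card_compl, x.2, Fintype.card_fin, Nat.cast_sub hDn]
  -- As `P` and `Q` have total zero, the local adjacency multiplies the part `Q j` by `n - D - 2`
  -- and the part `P k` by `D - 2`. This shift removes `Q` and scales `P` by `2D - n`, nonzero since
  -- `n > 2D`.
  set w₂ := E *ᵥ (adjacency (johnson n D) *ᵥ w₁) + (2 - ((n : ℂ) - D)) • w₁ with hw₂
  have hw₂W : w₂ ∈ W := W.add_mem (hEmem _ (hAmem _ hw₁W)) (W.smul_mem _ hw₁W)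
  have hw₂1 : ∀ y, level x y ≠ 1 → w₂ y = 0 := hsupp _ _ _ hw₁1
  have hm₂ : ∀ j ∈ x.1, ∀ k ∉ x.1, neighborValue x w₂ j k = ((2 * D : ℂ) - n) * P k := by
    intro j hj k hk
    rw [hw₂, hadd _ _ _ hj hk, hE, neighborValue_dualIdempotent _ hj hk,
      neighborValue_adjacency hw₁1 hj hk, hm₁ j hj k hk,
      Finset.sum_congr rfl fun i hi => hm₁ i hi k hk,
      Finset.sum_congr rfl fun l hl => hm₁ j hj l (Finset.mem_compl.1 hl),
      Finset.sum_add_distrib, Finset.sum_add_distrib, hP0, hQ0, Finset.sum_const, Finset.sum_const,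
      nsmul_eq_mul, nsmul_eq_mul, hcard, x.2]
    ring
  have hr : (2 * D : ℂ) - n ≠ 0 := by
    rw [sub_ne_zero]
    exact_mod_cast hn.ne
  have hdisj : Disjoint x.1 x.1ᶜ := disjoint_compl_right
  have hsmul : ∀ (r : ℂ) (ψ : Finset (Fin n) → ℂ) {j k : Fin n}, j ∈ x.1 → k ∉ x.1 →
      neighborValue x (r • (E *ᵥ restrict n D ψ)) j k = r * ψ (insert k (x.1.erase j)) := by
    intro r ψ j k hj hk
    rw [← neighborValue_restrict ψ hj hk, ← neighborValue_dualIdempotent (restrict n D ψ) hj hk,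
      neighborValue_eq x _ hj hk, neighborValue_eq x _ hj hk, Pi.smul_apply, smul_eq_mul]
  have hmem : ∀ (r : ℂ) (ψ : Finset (Fin n) → ℂ) (v : JohnsonVertex n D → ℂ), r ≠ 0 → v ∈ W →
      (∀ y, level x y ≠ 1 → v y = 0) →
      (∀ j ∈ x.1, ∀ k ∉ x.1, r * ψ (insert k (x.1.erase j)) = neighborValue x v j k) →
      E *ᵥ restrict n D ψ ∈ W := by
    intro r ψ v hr hv hv1 h
    have : r • (E *ᵥ restrict n D ψ) = v := by
      refine eq_of_neighborValue_eq ?_ hv1 fun j hj k hk => ?_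
      · intro y hy
        rw [Pi.smul_apply, hE, dualIdempotent_one_apply_of_level_ne _ y hy, smul_zero]
      · rw [hsmul r ψ hj hk, h j hj k hk]
    exact (W.smul_mem_iff hr).1 (this ▸ hv)
  have hval : ∀ (ψ : Finset (Fin n) → ℂ) {j k : Fin n}, j ∈ x.1 → k ∉ x.1 →
      ψ (insert k (x.1.erase j)) ≠ 0 → ∃ y, level x y = 1 ∧ restrict n D ψ y ≠ 0 :=
    fun ψ j k hj hk h => ⟨swap x hj hk, level_swap_base x hj hk, h⟩
  have hsum : ∀ (g : Fin n → ℂ), ∑ i ∈ x.1, g i = 0 → ∀ j ∈ x.1, ∑ i ∈ x.1.erase j, g i = -g j := by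
    intro g hg j hj
    rw [← Finset.add_sum_erase _ _ hj] at hg
    linear_combination hg
  obtain ⟨y, hy⟩ := Function.ne_iff.1 hne
  have hy1 : level x y = 1 := by
    by_contra h
    exact hy (hw1 y h)
  obtain ⟨j₀, k₀, hj₀, hk₀, rfl⟩ := exists_swap_of_level_one hy1
  have hm0 : m j₀ k₀ ≠ 0 := by
    rw [hm, neighborValue_eq x _ hj₀ hk₀]
    exact hy
  by_cases hPz : ∃ k ∉ x.1, P k ≠ 0
  · obtain ⟨k, hk, hPk⟩ := hPz
    have hφ : ∀ j ∈ x.1, ∀ k ∉ x.1, ∑ l ∈ x.1ᶜ ∩ insert k (x.1.erase j), P l = P k := by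
      intro j hj k hk
      rw [compl_inter_swap hk, Finset.sum_singleton]
    refine ⟨0, 1, _, by omega, by omega, by omega, isHarmonic_zero_sum hdisj.symm P,
      isHarmonic_one_sum hP0, hval _ hj₀ hk ?_, hmem _ _ w₂ hr hw₂W hw₂1 fun j hj k hk => ?_⟩
    · rwa [hφ j₀ hj₀ k hk]
    · rw [hφ j hj k hk, hm₂ j hj k hk]
  push Not at hPz
  by_cases hQz : ∃ j ∈ x.1, Q j ≠ 0
  · obtain ⟨j, hj, hQj⟩ := hQz
    have hφ : ∀ j ∈ x.1, ∀ k ∉ x.1, ∑ l ∈ x.1 ∩ insert k (x.1.erase j), Q l = -Q j := by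
      intro j hj k hk
      rw [inter_swap hk, hsum Q hQ0 j hj]
    refine ⟨1, 0, _, by omega, by omega, by omega, isHarmonic_one_sum hQ0,
      isHarmonic_zero_sum hdisj Q, hval _ hj hk₀ ?_,
      hmem (-1) _ w₁ (by norm_num) hw₁W hw₁1 fun j hj k hk => ?_⟩
    · rw [hφ j hj k₀ hk₀]
      exact neg_ne_zero.2 hQj
    · rw [hφ j hj k hk, hm₁ j hj k hk, hPz k hk]
      ring
  push Not at hQz
  -- All line sums of `m` now vanish, so `m` defines a function of degrees `(1, 1)`. Replacing `j`
  -- by `k` leaves the entries of column `k` other than the one at `j`, whose sum is `-m j k`; hence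
  -- the factor -1 below.
  have hφ : ∀ j ∈ x.1, ∀ k ∉ x.1, ∑ i ∈ x.1 ∩ insert k (x.1.erase j),
      ∑ l ∈ x.1ᶜ ∩ insert k (x.1.erase j), m i l = -m j k := by
    intro j hj k hk
    simp only [inter_swap hk, compl_inter_swap hk, Finset.sum_singleton]
    exact hsum (fun i => m i k) (hPz k hk) j hj
  refine ⟨1, 1, fun z => ∑ i ∈ x.1 ∩ z, ∑ l ∈ x.1ᶜ ∩ z, m i l, le_rfl, le_rfl, by omega,
    isHarmonic_one_sum_sum hdisj fun k hk => hPz k (Finset.mem_compl.1 hk), ?_,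
    hval _ hj₀ hk₀ ?_, hmem (-1) _ w (by norm_num) hwW hw1 fun j hj k hk => ?_⟩
  · have := isHarmonic_one_sum_sum (m := fun l i => m i l) hdisj.symm hQz
    convert this using 2 with z
    exact Finset.sum_comm
  · rw [hφ j₀ hj₀ k₀ hk₀]
    exact neg_ne_zero.2 hm0
  · rw [hφ j hj k hk]
    ring

theorem isIrreducibleTModule_radialSpan_johnson (hD : 2 ≤ D) (hn : 2 * D < n)
    (hx : IsHarmonic x.1 a φ) (hx' : IsHarmonic x.1ᶜ b φ) (ha : a ≤ 1) (hb : b ≤ 1)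
    (hab : 1 ≤ a + b) (h1 : ∃ y, level x y = 1 ∧ restrict n D φ y ≠ 0) :
    IsIrreducibleTModule (johnson n D) x (radialSpan (johnson n D) x (restrict n D φ)) :=
  (isLadder_restrict hx hx').isIrreducibleTModule (r := 1) (e := D - a) (by omega)
    (johnson_support_iff hx hx' ha hb hab hn h1)
    (fun _ _ _ => johnsonCoeff_succ_self_ne_zero (by omega) (by omega))
    (fun _ _ _ => johnsonCoeff_self_succ_ne_zero (by omega) (by omega))

theorem dualSupport_radialSpan_johnson (hn : 2 * D < n)
    (hx : IsHarmonic x.1 a φ) (hx' : IsHarmonic x.1ᶜ b φ) (ha : a ≤ 1) (hb : b ≤ 1)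
    (hab : 1 ≤ a + b) (h1 : ∃ y, level x y = 1 ∧ restrict n D φ y ≠ 0) :
    dualSupport (johnson n D) x (radialSpan (johnson n D) x (restrict n D φ))
      = Finset.Icc 1 (D - a) := by
  rw [dualSupport_radialSpan]
  ext i
  exact johnson_support_iff hx hx' ha hb hab hn h1 i

theorem moduleDiameter_radialSpan_johnson (hn : 2 * D < n)
    (hx : IsHarmonic x.1 a φ) (hx' : IsHarmonic x.1ᶜ b φ) (ha : a ≤ 1) (hb : b ≤ 1)
    (hab : 1 ≤ a + b) (h1 : ∃ y, level x y = 1 ∧ restrict n D φ y ≠ 0) :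
    moduleDiameter (johnson n D) x (radialSpan (johnson n D) x (restrict n D φ)) = D - a - 1 := by
  rw [moduleDiameter, dualSupport_radialSpan_johnson hn hx hx' ha hb hab h1, Set.ncard_coe_finset,
    Nat.card_Icc]
  omega

/-- The irreducible modules with endpoint one and diameter `D - 2` are the modules of harmonic
functions of degree one on `x`. -/
theorem exists_radialSpan_eq (hD : 3 ≤ D) (hn : 2 * D < n)
    {W : Submodule ℂ (JohnsonVertex n D → ℂ)} (hW : IsIrreducibleTModule (johnson n D) x W)
    (hend : endpoint (johnson n D) x W = 1) (hdiam : moduleDiameter (johnson n D) x W = D - 2) :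
    ∃ (b : ℕ) (φ : Finset (Fin n) → ℂ), b ≤ 1 ∧ IsHarmonic x.1 1 φ ∧ IsHarmonic x.1ᶜ b φ ∧
      (∃ y, level x y = 1 ∧ restrict n D φ y ≠ 0) ∧
      W = radialSpan (johnson n D) x (restrict n D φ) := by
  obtain ⟨a, b, φ, ha, hb, hab, hx, hx', h1, hmem⟩ := exists_harmonic_of_endpoint_one hn hW.1 hend
  have hirr := isIrreducibleTModule_radialSpan_johnson (by omega) hn hx hx' ha hb hab h1
  have hne : dualIdempotent (johnson n D) x 1 *ᵥ restrict n D φ ≠ 0 := by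
    obtain ⟨y, hy, hφ⟩ := h1
    intro h
    have := congrFun h y
    rw [dualIdempotent_mulVec_apply, johnson_dist, if_pos hy] at this
    exact hφ this
  have hle : radialSpan (johnson n D) x (restrict n D φ) ≤ W := by
    rcases hirr.2.2 _ (hW.1.inf hirr.1) inf_le_right with h | h
    · exfalso
      have : dualIdempotent (johnson n D) x 1 *ᵥ restrict n D φ
          ∈ W ⊓ radialSpan (johnson n D) x (restrict n D φ) :=
        ⟨hmem, dualIdempotent_mulVec_mem_radialSpan 1 _⟩
      rw [h, Submodule.mem_bot] at this
      exact hne this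
    · exact inf_eq_right.1 h
  have hWeq : W = radialSpan (johnson n D) x (restrict n D φ) :=
    ((hW.2.2 _ hirr.1 hle).resolve_left hirr.2.1).symm
  rw [hWeq, moduleDiameter_radialSpan_johnson hn hx hx' ha hb hab h1] at hdiam
  -- The diameter of the ladder module is `D - a - 1`.
  obtain rfl : a = 1 := by omega
  exact ⟨b, φ, hb, hx, hx', h1, hWeq⟩

theorem isIrreducibleOfType_radialSpan_johnson (hD : 3 ≤ D) (hn : 2 * D < n)
    (hx : IsHarmonic x.1 1 φ) (hx' : IsHarmonic x.1ᶜ b φ) (hb : b ≤ 1)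
    (h1 : ∃ y, level x y = 1 ∧ restrict n D φ y ≠ 0) :
    IsIrreducibleOfType (johnson n D) x 1 (D - 2) (1 + b)
      (radialSpan (johnson n D) x (restrict n D φ)) := by
  have h0 : restrict n D φ ≠ 0 := by
    obtain ⟨y, -, hy⟩ := h1
    exact fun h => hy (congrFun h y)
  refine ⟨isIrreducibleTModule_radialSpan_johnson (by omega) hn hx hx' le_rfl hb (by omega) h1, ?_,
    ?_, dualEndpoint_radialSpan (by omega) hn.le hx hx' le_rfl hb h0⟩
  · rw [endpoint, dualSupport_radialSpan_johnson hn hx hx' le_rfl hb (by omega) h1]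
    have hleast : IsLeast ((Finset.Icc 1 (D - 1) : Finset ℕ) : Set ℕ) 1 :=
      ⟨by simp; omega, fun i hi => (Finset.mem_Icc.1 hi).1⟩
    exact hleast.csInf_eq
  · rw [moduleDiameter_radialSpan_johnson hn hx hx' le_rfl hb (by omega) h1]
    omega

theorem exists_radialSpan_eq_of_type (hD : 3 ≤ D) (hn : 2 * D < n) {t : ℕ}
    {W : Submodule ℂ (JohnsonVertex n D → ℂ)}
    (hW : IsIrreducibleOfType (johnson n D) x 1 (D - 2) t W) :
    ∃ (b : ℕ) (φ : Finset (Fin n) → ℂ), b ≤ 1 ∧ t = 1 + b ∧ IsHarmonic x.1 1 φ ∧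
      IsHarmonic x.1ᶜ b φ ∧ (∃ y, level x y = 1 ∧ restrict n D φ y ≠ 0) ∧
      W = radialSpan (johnson n D) x (restrict n D φ) := by
  obtain ⟨hirr, hend, hdiam, ht⟩ := hW
  obtain ⟨b, φ, hb, hx, hx', h1, rfl⟩ := exists_radialSpan_eq hD hn hirr hend hdiam
  exact ⟨b, φ, hb, ht ▸ (isIrreducibleOfType_radialSpan_johnson hD hn hx hx' hb h1).2.2.2, hx, hx',
    h1, rfl⟩

theorem radialSpan_fullGraph_johnson (x : JohnsonVertex n D) (f : JohnsonVertex n D → ℂ) :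
    radialSpan (johnson n D) x f = radialSpan (fullGraph (johnson n D) x) x f := by
  have : radialMul (johnson n D) x f = radialMul (fullGraph (johnson n D) x) x f := by
    ext s y
    rw [radialMul_apply, radialMul_apply, johnson_dist, fullGraph_johnson_dist]
  rw [radialSpan, radialSpan, this]

end Johnson

end

end UniformStructure

/-! ### Combination of the two parts -/

theorem theorem9p4 (n D : ℕ) (hD : 3 ≤ D) (hn : 2 * D ≤ n)
    (x : UniformStructure.JohnsonVertex n D) :
    -- `J(n, D)` does not support a uniform structure
    ¬ UniformStructure.SupportsUniformStructure (UniformStructure.johnson n D) x ∧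
    (2 * D < n →
      -- the irreducible `T`-modules of endpoint `1` and diameter `D - 2` have dual endpoint
      -- `1` or `2`, both occur, and each dual endpoint occurs exactly once up to isomorphism
      (∃ W, UniformStructure.IsIrreducibleOfType (UniformStructure.johnson n D) x 1 (D - 2) 1 W) ∧
      (∃ W, UniformStructure.IsIrreducibleOfType (UniformStructure.johnson n D) x 1 (D - 2) 2 W) ∧
      (∀ t W, UniformStructure.IsIrreducibleOfType (UniformStructure.johnson n D) x 1 (D - 2) t W →
        t = 1 ∨ t = 2) ∧
      (∀ t W W',
        UniformStructure.IsIrreducibleOfType (UniformStructure.johnson n D) x 1 (D - 2) t W →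
        UniformStructure.IsIrreducibleOfType (UniformStructure.johnson n D) x 1 (D - 2) t W' →
        UniformStructure.IsTIsomorphic (UniformStructure.johnson n D) x W W') ∧
      -- the two modules are `T_f`-modules, and are not isomorphic as such
      (∀ W W',
        UniformStructure.IsIrreducibleOfType (UniformStructure.johnson n D) x 1 (D - 2) 1 W →
        UniformStructure.IsIrreducibleOfType (UniformStructure.johnson n D) x 1 (D - 2) 2 W' →
        UniformStructure.IsTModule
          (UniformStructure.fullGraph (UniformStructure.johnson n D) x) x W ∧
        UniformStructure.IsTModule
          (UniformStructure.fullGraph (UniformStructure.johnson n D) x) x W' ∧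
        ¬ UniformStructure.IsTIsomorphic
          (UniformStructure.fullGraph (UniformStructure.johnson n D) x) x W W')) := by
  open UniformStructure in
  refine ⟨not_supportsUniformStructure_johnson hD hn x, fun hn' => ⟨?_, ?_, ?_, ?_, ?_⟩⟩
  · obtain ⟨φ, hx, hx', h1⟩ := exists_isHarmonic x (by omega) hn le_rfl zero_le_one
    exact ⟨_, isIrreducibleOfType_radialSpan_johnson hD hn' hx hx' zero_le_one h1⟩
  · obtain ⟨φ, hx, hx', h1⟩ := exists_isHarmonic x (by omega) hn le_rfl le_rfl
    exact ⟨_, isIrreducibleOfType_radialSpan_johnson hD hn' hx hx' le_rfl h1⟩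
  · intro t W hW
    obtain ⟨b, φ, hb, rfl, -⟩ := exists_radialSpan_eq_of_type hD hn' hW
    omega
  · intro t W W' hW hW'
    obtain ⟨b, φ, hb, rfl, hx, hx', h1, rfl⟩ := exists_radialSpan_eq_of_type hD hn' hW
    obtain ⟨b', φ', hb', hbb, hy, hy', h1', rfl⟩ := exists_radialSpan_eq_of_type hD hn' hW'
    obtain rfl : b = b' := by omega
    refine (isLadder_restrict hx hx').isTIsomorphic (isLadder_restrict hy hy') fun i => ?_
    rw [johnson_support_iff hx hx' le_rfl hb (by omega) hn' h1,
      johnson_support_iff hy hy' le_rfl hb (by omega) hn' h1']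
  · intro W W' hW hW'
    obtain ⟨b, φ, hb, hb1, hx, hx', h1, rfl⟩ := exists_radialSpan_eq_of_type hD hn' hW
    obtain ⟨b', φ', hb', hb1', hy, hy', h1', rfl⟩ := exists_radialSpan_eq_of_type hD hn' hW'
    obtain rfl : b = 0 := by omega
    obtain rfl : b' = 1 := by omega
    have hl := isLadder_fullGraph_restrict hx hx'
    have hl' := isLadder_fullGraph_restrict hy hy'
    rw [radialSpan_fullGraph_johnson, radialSpan_fullGraph_johnson]
    refine ⟨hl.isTModule, hl'.isTModule, fun hσ => ?_⟩
    -- The walk from level 1 to level 2 and back has scalar `2(n - D - 1)(D - 2)` for `b = 0` and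
    -- `(n - D - 2)(D - 2)` for `b = 1`. Their difference is `(D - 2)(n - D)`, which is nonzero.
    have h := hl.coeff_mul_eq_of_isTIsomorphic hl' (i := 1) 2 (fun h0 => by
      obtain ⟨y, hy, hφ⟩ := h1
      have := congrFun h0 y
      rw [dualIdempotent_mulVec_apply, fullGraph_johnson_dist, if_pos hy] at this
      exact hφ this) hσ
    simp only [show (1 : ℕ) ≠ 2 by omega, show (2 : ℕ) ≠ 1 by omega, if_false] at h
    rw [johnsonCoeff_succ_self n D 1 0 1, johnsonCoeff_succ_self n D 1 1 1,
      johnsonCoeff_self_succ n D 1 0 1, johnsonCoeff_self_succ n D 1 1 1] at h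
    push_cast at h
    have h2 : ((D : ℂ) - 2) * (n - D) = 0 := by linear_combination h
    rcases mul_eq_zero.1 h2 with h3 | h3
    · rw [sub_eq_zero] at h3
      have : D = 2 := by exact_mod_cast h3
      omega
    · rw [sub_eq_zero] at h3
      have : n = D := by exact_mod_cast h3
      omega
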